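/- Let $K\ge 2$ and $1\le m_0\le K$ be integers. For each $k\in[K]=\{1,\dots,K\}$ let $\mathcal X^k$ be a measurable space with a $\sigma$-finite measure $\mu^k$, and let $f_0^k,f_1^k$ be two probability densities with respect to $\mu^k$. For $A\subset[K]$ let $\mathbb P_A$ be the law under which the streams $\mathbf X^k=(\mathbf X^k_1,\mathbf X^k_2,\dots)$, $k\in[K]$, are independent and, for each $k$, the $\mathbf X^k_t$ are i.i.d. with density $f_1^k$ if $k\in A$ and $f_0^k$ if $k\notin A$. Write $\mathbb E_A$ for the corresponding expectation and $\mathcal F_t=\sigma(\mathbf X^k_s: k\in[K],\,1\le s\le t)$. Suppose that, for every $k\in[K]$ and $(i,i')\in\{(0,1),(1,0)\}$, $$\int \log\!\left(f_i^k/f_{i'}^k\right) f_i^k\,d\mu^k>0\qquad\text{and}\qquad \int\left[\log\!\left(f_i^k/f_{i'}^k\right)\right]^2 f_i^k\,d\mu^k<\infty ,$$ where $\log(a/0)=\infty$ for $a>0$. A sequential procedure is a pair $(T,D)$, where $T$ is an $\{\mathcal F_t\}$-stopping time with values in $\{1,2,\dots\}\cup\{\infty\}$ and $D\subset[K]$ is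 an $\mathcal F_T$-measurable random set. For $\alpha\in(0,1)$ let $\Delta^{\mathrm{gmr}}_{m_0}(\alpha)$ be the class of all sequential procedures $(T,D)$ with $\mathbb P_A(|D\,\triangle\,A|\ge m_0)\le\alpha$ for every $A\subset[K]$, and let $$T_A^{\min}\bigl(\Delta^{\mathrm{gmr}}_{m_0}(\alpha)\bigr)=\inf_{(T,D)\in\Delta^{\mathrm{gmr}}_{m_0}(\alpha)}\mathbb E_A[T].$$ Let $\lambda_t^k=\sum_{s=1}^t\log\bigl(f_1^k(\mathbf X_s^k)/f_0^k(\mathbf X_s^k)\bigr)$, and let $\tilde\lambda_t^{(1)}\le\dots\le\tilde\lambda_t^{(K)}$ be the order statistics of $\{|\lambda_t^k|:k\in[K]\}$. The Sum-Intersection rule $\delta_S(b)=(T_S(b),D_S(b))$ with threshold $b>0$ is $$T_S(b)=\min\Bigl\{t\ge1:\ \sum_{i=1}^{m_0}\tilde\lambda_t^{(i)}\ge b\Bigr\},\qquad D_S(b)=\bigl\{k\in[K]:\lambda^k_{T_S(b)}>0\bigr\},$$ with $T_S(b)=\infty$ and $D_S(b)=\emptyset$ if there is no such $t$. For $\alpha\in(0,1)$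 put $b_\alpha=|\log\alpha|+\log\binom{K}{m_0}$. Then the family $\{\delta_S(b_\alpha)\}$ is second-order asymptotically optimal in $\{\Delta^{\mathrm{gmr}}_{m_0}(\alpha)\}$ as $\alpha\to0$. That is, $\delta_S(b_\alpha)\in\Delta^{\mathrm{gmr}}_{m_0}(\alpha)$ for every $\alpha\in(0,1)$, and for every $A\subset[K]$ one has $\mathbb E_A[T_S(b_\alpha)]<\infty$ for every $\alpha\in(0,1)$ and $$\limsup_{\alpha\to0}\Bigl(\mathbb E_A[T_S(b_\alpha)]-T_A^{\min}\bigl(\Delta^{\mathrm{gmr}}_{m_0}(\alpha)\bigr)\Bigr)<\infty .$$ -/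

import Mathlib

open MeasureTheory Filter Topology
open scoped ENNReal NNReal symmDiff

noncomputable section

namespace SeqMultTest

/-- `K` data streams, indexed by `Fin K`. Stream `k` takes values in `X k`, which carries a
`σ`-finite reference measure `μ k` and two probability densities: `f k 0` (null hypothesis) and
`f k 1` (alternative hypothesis). -/
structure StreamModel (K : ℕ) where
  X : Fin K → Type*
  mX : ∀ k, MeasurableSpace (X k)
  μ : ∀ k, Measure (X k)
  sigmaFinite : ∀ k, SigmaFinite (μ k)
  f : ∀ k, Fin 2 → X k → ℝ≥0
  measurable_f : ∀ k i, Measurable (f k i)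
  lintegral_f : ∀ k i, ∫⁻ x, (f k i x : ℝ≥0∞) ∂(μ k) = 1

namespace StreamModel

variable {K : ℕ} (M : StreamModel K)

instance (k : Fin K) : MeasurableSpace (M.X k) := M.mX k

/-- Law of one observation of stream `k` under hypothesis `i`. -/
def obsLaw (k : Fin K) (i : Fin 2) : Measure (M.X k) :=
  (M.μ k).withDensity fun x => (M.f k i x : ℝ≥0∞)

instance (k : Fin K) (i : Fin 2) : IsProbabilityMeasure (M.obsLaw k i) :=
  ⟨by rw [obsLaw, withDensity_apply _ MeasurableSet.univ, Measure.restrict_univ, M.lintegral_f]⟩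

/-- The moment assumption: in every stream and for `(i, i') ∈ {(0,1), (1,0)}`, the
Kullback-Leibler divergence is positive and the log-likelihood ratio has a finite second moment.

The second moment is computed with the extended-real logarithm, `log (a / 0) = ∞` for `a > 0`;
its finiteness therefore makes the log-likelihood ratio finite almost everywhere under
hypothesis `i`, and integrable, so that the first condition is about a genuine integral. -/
def MomentAssumption : Prop :=
  ∀ k : Fin K, ∀ i i' : Fin 2, i ≠ i' →
    0 < ∫ x, Real.log ((M.f k i x : ℝ) / (M.f k i' x : ℝ)) * (M.f k i x : ℝ) ∂(M.μ k) ∧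
    ∫⁻ x, (ENNReal.log ((M.f k i x : ℝ≥0∞) / (M.f k i' x : ℝ≥0∞))).abs ^ 2 *
      (M.f k i x : ℝ≥0∞) ∂(M.μ k) < ⊤

/-- The sample space: `ω k s` is the observation of stream `k` at time `s + 1`. -/
abbrev Path : Type _ := ∀ k : Fin K, ℕ → M.X k

/-- The joint law of all the streams when `A` is the set of signals: the streams are independent,
and stream `k` is i.i.d. with density `f k 1` if `k ∈ A` and `f k 0` otherwise. -/
def law (A : Finset (Fin K)) : Measure M.Path :=
  Measure.pi fun k =>
    Measure.infinitePi fun _ : ℕ => M.obsLaw k (if k ∈ A then 1 else 0)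

/-- `filtration t` is generated by the observations of all streams at the times `1, …, t`. -/
def filtration : Filtration ℕ (inferInstance : MeasurableSpace M.Path) where
  seq t := ⨆ (s : ℕ) (_ : s < t) (k : Fin K),
    MeasurableSpace.comap (fun ω : M.Path => ω k s) (M.mX k)
  mono' _ _ h := iSup_mono fun _ => iSup_mono' fun hs => ⟨lt_of_lt_of_le hs h, le_rfl⟩
  le' _ := iSup_le fun s => iSup_le fun _ => iSup_le fun k =>
    Measurable.comap_le ((measurable_pi_apply s).comp (measurable_pi_apply k))

/-- A pair consisting of a time at which sampling stops (possibly `∞`) and of the set of streams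
then declared to be signals. -/
structure Rule where
  T : M.Path → ℕ∞
  D : M.Path → Finset (Fin K)

/-- A sequential multiple testing procedure: `T` is a stopping time with values in
`{1, 2, …} ∪ {∞}` and every component of `D` is measurable with respect to the `σ`-field of
events observed up to time `T`. -/
def IsProcedure (δ : M.Rule) : Prop :=
  (∀ ω, 1 ≤ δ.T ω) ∧
    ∃ hT : IsStoppingTime M.filtration δ.T,
      ∀ k : Fin K, MeasurableSet[hT.measurableSpace] {ω | k ∈ δ.D ω}

/-- The expected sample size `E_A[T]`. -/
def ess (A : Finset (Fin K)) (δ : M.Rule) : ℝ≥0∞ :=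
  ∫⁻ ω, (δ.T ω : ℝ≥0∞) ∂(M.law A)

/-- The minimal achievable expected sample size over a class of procedures. -/
def minEss (A : Finset (Fin K)) (C : Set M.Rule) : ℝ≥0∞ :=
  ⨅ δ ∈ C, M.ess A δ

/-- The class of procedures which, whatever the set of signals, commit at least `m₀` mistakes with
probability at most `α`. -/
def gmrClass (m₀ : ℕ) (α : ℝ) : Set M.Rule :=
  {δ | M.IsProcedure δ ∧
    ∀ A : Finset (Fin K), M.law A {ω | m₀ ≤ (δ.D ω ∆ A).card} ≤ ENNReal.ofReal α}

/-- Second-order asymptotic optimality as `α → 0` of a family of procedures `δ α` in a family of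
classes `C α`, `α ∈ (0, 1)`. The expected sample sizes are required to be finite, so that the
difference is never the indeterminate `∞ - ∞`. -/
def IsSecondOrderOptimal (δ : ℝ → M.Rule) (C : ℝ → Set M.Rule) : Prop :=
  (∀ α ∈ Set.Ioo (0 : ℝ) 1, δ α ∈ C α) ∧
    ∀ A : Finset (Fin K),
      (∀ α ∈ Set.Ioo (0 : ℝ) 1, M.ess A (δ α) < ⊤) ∧
      limsup (fun α : ℝ => (M.ess A (δ α) : EReal) - (M.minEss A (C α) : EReal)) (𝓝[>] 0) < ⊤

/-- The log-likelihood ratio of stream `k` at time `t`. -/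
def llr (k : Fin K) (t : ℕ) (ω : M.Path) : ℝ :=
  ∑ s ∈ Finset.range t, Real.log ((M.f k 1 (ω k s) : ℝ) / (M.f k 0 (ω k s) : ℝ))

/-- The order statistics of the absolute log-likelihood ratios at time `t`:
`orderedAbsLlr t ω i` is the `(i + 1)`-st smallest of the numbers `|llr k t ω|`. -/
def orderedAbsLlr (t : ℕ) (ω : M.Path) (i : Fin K) : ℝ :=
  |M.llr (Tuple.sort (fun k => |M.llr k t ω|) i) t ω|

/-- The sum of the `m₀` smallest absolute log-likelihood ratios at time `t`. -/
def sumSmallest (m₀ t : ℕ) (ω : M.Path) : ℝ :=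
  ∑ i ∈ {i : Fin K | i.val < m₀}, M.orderedAbsLlr t ω i

open Classical in
/-- The Sum-Intersection rule with threshold `b`: stop at the first `t ≥ 1` at which the sum of the
`m₀` smallest absolute log-likelihood ratios is at least `b` (and never, if there is no such `t`),
and then declare a signal in the streams whose log-likelihood ratio is positive. -/
def sumIntersection (m₀ : ℕ) (b : ℝ) : M.Rule where
  T ω := ⨅ (t : ℕ) (_ : 1 ≤ t ∧ b ≤ M.sumSmallest m₀ t ω), (t : ℕ∞)
  D ω := Finset.univ.filter fun k => ∃ t : ℕ,
    (⨅ (t : ℕ) (_ : 1 ≤ t ∧ b ≤ M.sumSmallest m₀ t ω), (t : ℕ∞)) = t ∧ 0 < M.llr k t ω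

end StreamModel

end SeqMultTest

end

noncomputable section

namespace SeqMultTest

open ProbabilityTheory

/-! Fix `A` and an arbitrary procedure `(τ, D)`, and let `x_k` be the log-likelihood ratio of stream
`k` signed so that it has positive drift under `P_A`. The Sum-Intersection time `T` is compared with
`τ` directly, without any separate lower bound on `E_A[τ]`.

Consider the potential `V_t = ∑_{|C| = m₀} ((b + R - ∑_{k ∈ C} x_k(t))⁺)²`. While the rule is
running, some block sum lies below `b`, so its shortfall is at least `R`. For `R` large its drift
beats the second moments of all the blocks together, and `V` loses at least 1 in mean per step
(`setLIntegral_sum_shortfall_sq_add_le`). Hence `E_A[(T - τ)⁺] ≤ E_A[V_τ; τ < T]`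
(`ess_sumIntersection_le`).

If the rule is still running at `τ`, then whatever `D` is, some `B` with `|D ∆ B| ≥ m₀` is fairly
likely relative to `A`. Quantitatively, `V_τ ≤ const · e^b · ∑_{B : |D ∆ B| ≥ m₀} dP_B/dP_A`
(`exists_alternative`, `sum_shortfall_sq_le`). A change of measure (`law_eq_setLIntegral`) turns the
expectation of the right side into `const · e^b · ∑_B P_B(|D ∆ B| ≥ m₀)`. Over the class this is at
most `const · e^b · 2^K · α`, which is constant in `α` for `b = b_α`.

Taking for `(τ, D)` a rule that stops at time 1 gives finiteness of `E_A[T]`. The error bound comes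
from another change of measure, to `A ∆ C`, and a union bound over the sets `C` of `m₀` streams. -/

/-! ### One-step drift of squared shortfalls -/

/-- The positive part squared grows at most quadratically along one step. -/
lemma max_sub_zero_sq_le (x z : ℝ) :
    max (x - z) 0 ^ 2 ≤ max x 0 ^ 2 - 2 * (max x 0 * z) + z ^ 2 := by
  rcases le_total x 0 with hx | hx
  · rw [max_eq_right hx]
    rcases le_total (x - z) 0 with h | h
    · rw [max_eq_right h]; nlinarith [sq_nonneg z]
    · rw [max_eq_left h]; nlinarith
  · rw [max_eq_left hx]
    rcases le_total (x - z) 0 with h | h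
    · rw [max_eq_right h]; nlinarith [sq_nonneg (x - z)]
    · rw [max_eq_left h]; nlinarith

/-- One-step drift inequality for the sum of the squared shortfalls of finitely many walks. -/
lemma setLIntegral_sum_shortfall_sq_add_le {Ω ι : Type*} {m mΩ : MeasurableSpace Ω} {P : Measure Ω}
    [IsProbabilityMeasure P] (hm : m ≤ mΩ) (s : Finset ι) (Y Z : ι → Ω → ℝ)
    (hY : ∀ i ∈ s, Measurable[m] (Y i)) (hY2 : ∀ i ∈ s, MemLp (Y i) 2 P)
    (hZ : ∀ i ∈ s, Measurable (Z i)) (hZ2 : ∀ i ∈ s, MemLp (Z i) 2 P)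
    (hind : ∀ i ∈ s, Indep m (MeasurableSpace.comap (Z i) inferInstance) P)
    (hmean : ∀ i ∈ s, 0 ≤ ∫ ω, Z i ω ∂P) (b R : ℝ)
    (hlarge : ∀ i ∈ s, 1 + ∑ j ∈ s, ∫ ω, Z j ω ^ 2 ∂P ≤ 2 * R * ∫ ω, Z i ω ∂P)
    {E : Set Ω} (hE : MeasurableSet[m] E) (hEb : ∀ ω ∈ E, ∃ i ∈ s, Y i ω < b) :
    (∫⁻ ω in E, ENNReal.ofReal (∑ i ∈ s, max (b + R - (Y i ω + Z i ω)) 0 ^ 2) ∂P) + P E ≤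
      ∫⁻ ω in E, ENNReal.ofReal (∑ i ∈ s, max (b + R - Y i ω) 0 ^ 2) ∂P := by
  have hE' : MeasurableSet E := hm _ hE
  set U : ι → Ω → ℝ := fun i ω => max (b + R - Y i ω) 0 with hU
  have hUm : ∀ i ∈ s, Measurable[m] (U i) := fun i hi =>
    (measurable_const.sub (hY i hi)).max measurable_const
  have memmax : ∀ f : Ω → ℝ, MemLp f 2 P → MemLp (fun ω => max (f ω) 0) 2 P := fun f hf => hf.pos_part
  have hU2 : ∀ i ∈ s, MemLp (U i) 2 P := fun i hi =>
    memmax _ ((memLp_const (b + R)).sub (hY2 i hi))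
  have hW2 : ∀ i ∈ s, MemLp (fun ω => max (b + R - (Y i ω + Z i ω)) 0) 2 P := fun i hi =>
    memmax _ ((memLp_const (b + R)).sub ((hY2 i hi).add (hZ2 i hi)))
  have hUE : ∀ i ∈ s, Measurable[m] (E.indicator (U i)) := fun i hi => (hUm i hi).indicator hE
  -- The indicator of `E` is absorbed into the `m`-measurable factor, so that independence applies
  -- on `E` without conditional expectations.
  have hcross : ∀ i ∈ s, ∫ ω in E, U i ω * Z i ω ∂P = (∫ ω in E, U i ω ∂P) * ∫ ω, Z i ω ∂P := by
    intro i hi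
    have hI : IndepFun (E.indicator (U i)) (Z i) P := by
      rw [IndepFun_iff_Indep]
      exact indep_of_indep_of_le_left (hind i hi) (hUE i hi).comap_le
    rw [← integral_indicator hE', ← integral_indicator hE',
      ← hI.integral_fun_mul_eq_mul_integral
        ((hUE i hi).mono hm le_rfl).aestronglyMeasurable (hZ i hi).aestronglyMeasurable]
    congr 1; ext ω
    by_cases h : ω ∈ E <;> simp [h]
  have hsq : ∀ i ∈ s, ∫ ω in E, Z i ω ^ 2 ∂P = P.real E * ∫ ω, Z i ω ^ 2 ∂P := by
    intro i hi
    have hI : IndepFun (E.indicator fun _ => (1 : ℝ)) (fun ω => Z i ω ^ 2) P := by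
      rw [IndepFun_iff_Indep]
      refine indep_of_indep_of_le_left (indep_of_indep_of_le_right (hind i hi) ?_)
        (measurable_const.indicator hE).comap_le
      exact ((comap_measurable (Z i)).pow_const 2).comap_le
    have := hI.integral_fun_mul_eq_mul_integral
        (measurable_const.indicator hE').aestronglyMeasurable
        ((hZ i hi).pow_const 2).aestronglyMeasurable
    rw [integral_indicator_const _ hE', smul_eq_mul, mul_one] at this
    rw [← this, ← integral_indicator hE']
    congr 1; ext ω
    by_cases h : ω ∈ E <;> simp [h]
  have iU : ∀ i ∈ s, Integrable (fun ω => U i ω ^ 2) P := fun i hi => (hU2 i hi).integrable_sq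
  have iW : ∀ i ∈ s, Integrable (fun ω => max (b + R - (Y i ω + Z i ω)) 0 ^ 2) P :=
    fun i hi => (hW2 i hi).integrable_sq
  have iZ : ∀ i ∈ s, Integrable (fun ω => Z i ω ^ 2) P := fun i hi => (hZ2 i hi).integrable_sq
  have iUZ : ∀ i ∈ s, Integrable (fun ω => U i ω * Z i ω) P :=
    fun i hi => (hU2 i hi).integrable_mul (hZ2 i hi)
  have iU1 : ∀ i ∈ s, Integrable (U i) P := fun i hi => (hU2 i hi).integrable (by norm_num)
  have hterm : ∀ i ∈ s, ∫ ω in E, max (b + R - (Y i ω + Z i ω)) 0 ^ 2 ∂P ≤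
      (∫ ω in E, U i ω ^ 2 ∂P) - 2 * ((∫ ω in E, U i ω ∂P) * ∫ ω, Z i ω ∂P)
        + P.real E * ∫ ω, Z i ω ^ 2 ∂P := by
    intro i hi
    rw [← hcross i hi, ← hsq i hi, ← integral_const_mul, ← integral_sub, ← integral_add]
    · refine integral_mono (iW i hi).integrableOn
        ((((iU i hi).sub ((iUZ i hi).const_mul 2)).add (iZ i hi)).integrableOn) fun ω => ?_
      simpa [sub_sub] using max_sub_zero_sq_le (b + R - Y i ω) (Z i ω)
    · exact ((iU i hi).sub ((iUZ i hi).const_mul 2)).integrableOn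
    · exact (iZ i hi).integrableOn
    · exact (iU i hi).integrableOn
    · exact ((iUZ i hi).const_mul 2).integrableOn
  -- On `E` some walk is below `b`, so its shortfall is at least `R`; by `hlarge` its drift term
  -- alone pays for every second moment and leaves 1 over. The other drift terms are nonnegative.
  have hgain : P.real E * (1 + ∑ j ∈ s, ∫ ω, Z j ω ^ 2 ∂P) ≤
      ∑ i ∈ s, 2 * ((∫ ω in E, U i ω ∂P) * ∫ ω, Z i ω ∂P) := by
    have h1 : ∑ i ∈ s, 2 * ((∫ ω in E, U i ω ∂P) * ∫ ω, Z i ω ∂P) =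
        ∫ ω in E, ∑ i ∈ s, 2 * (∫ ω', Z i ω' ∂P) * U i ω ∂P := by
      rw [integral_finsetSum _ fun i hi => ((iU1 i hi).const_mul _).integrableOn]
      refine Finset.sum_congr rfl fun i hi => ?_
      rw [integral_const_mul]; ring
    rw [h1, ← smul_eq_mul, ← setIntegral_const]
    refine setIntegral_mono_on (integrableOn_const (measure_ne_top _ _))
      (integrable_finsetSum _ fun i hi => (iU1 i hi).const_mul _).integrableOn hE' fun ω hω => ?_
    obtain ⟨i, hi, hlt⟩ := hEb ω hω
    have h2 : R ≤ U i ω := le_max_of_le_left (by linarith)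
    calc _ ≤ 2 * (∫ ω', Z i ω' ∂P) * R := by linarith [hlarge i hi]
      _ ≤ 2 * (∫ ω', Z i ω' ∂P) * U i ω := by
          have := hmean i hi
          gcongr
      _ ≤ _ := Finset.single_le_sum
          (f := fun i => 2 * (∫ ω', Z i ω' ∂P) * U i ω) (fun j hj => by
            have := hmean j hj
            have : 0 ≤ U j ω := le_max_right _ _
            positivity) hi
  have hreal : (∫ ω in E, ∑ i ∈ s, max (b + R - (Y i ω + Z i ω)) 0 ^ 2 ∂P) + P.real E ≤
      ∫ ω in E, ∑ i ∈ s, U i ω ^ 2 ∂P := by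
    rw [integral_finsetSum _ fun i hi => (iW i hi).integrableOn,
      integral_finsetSum _ fun i hi => (iU i hi).integrableOn]
    have := Finset.sum_le_sum hterm
    rw [Finset.sum_add_distrib, Finset.sum_sub_distrib,
      ← Finset.mul_sum _ _ (P.real E)] at this
    linarith
  rw [← ofReal_integral_eq_lintegral_ofReal
      (integrable_finsetSum _ fun i hi => (iW i hi)).integrableOn
      (Eventually.of_forall fun ω => Finset.sum_nonneg fun i _ => sq_nonneg _),
    ← ofReal_integral_eq_lintegral_ofReal
      (integrable_finsetSum _ fun i hi => (iU i hi)).integrableOn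
      (Eventually.of_forall fun ω => Finset.sum_nonneg fun i _ => sq_nonneg _),
    ← ofReal_measureReal (measure_ne_top _ _), ← ENNReal.ofReal_add _ measureReal_nonneg]
  · exact ENNReal.ofReal_le_ofReal hreal
  · exact integral_nonneg fun ω => Finset.sum_nonneg fun i _ => sq_nonneg _

/-! ### Shortfalls against likelihoods of alternatives -/

/-- For every decision `D` some set `B` differing from `D` in at least `C.card` places has large
weight relative to the signed walks `x`. -/
lemma exists_alternative {ι : Type*} [DecidableEq ι] [Fintype ι] (A D C : Finset ι) (x : ι → ℝ) :
    ∃ B : Finset ι, C.card ≤ (D ∆ B).card ∧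
      ∑ k ∈ A ∆ B, x k ≤ ∑ k ∈ C, |x k| - ∑ k, max (-x k) 0 := by
  classical
  -- On `C` the set contradicts `D`, which forces `C ⊆ D ∆ B` and costs at most the positive part of
  -- `x k`. Off `C` it departs from `A` exactly where `x k < 0`, which is the most likely choice.
  refine ⟨Finset.univ.filter fun k => if k ∈ C then k ∉ D else (k ∈ A ↔ 0 ≤ x k), ?_, ?_⟩
  · refine Finset.card_le_card fun k hk => ?_
    simp [Finset.mem_symmDiff, hk]
    tauto
  · rw [← Finset.univ_inter (A ∆ _), ← Finset.sum_ite_mem, ← Finset.univ_inter C,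
      ← Finset.sum_ite_mem, ← Finset.sum_sub_distrib]
    refine Finset.sum_le_sum fun k _ => ?_
    simp only [Finset.mem_symmDiff, Finset.mem_filter, Finset.mem_univ, true_and,
      Finset.univ_inter]
    rcases le_or_gt 0 (x k) with h | h
    · rw [abs_of_nonneg h, max_eq_right (by linarith : -x k ≤ 0)]
      split_ifs <;> first | linarith | tauto
    · rw [abs_of_neg h, max_eq_left (by linarith : 0 ≤ -x k)]
      have h' := not_le.2 h
      split_ifs <;> first | linarith | tauto

lemma exists_card_eq_sum_le {ι : Type*} [Fintype ι] (m : ℕ) (hm : m ≤ Fintype.card ι)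
    (f : ι → ℝ) :
    ∃ C : Finset ι, C.card = m ∧ ∀ C' : Finset ι, C'.card = m → ∑ k ∈ C, f k ≤ ∑ k ∈ C', f k := by
  obtain ⟨C, hC, h⟩ := Finset.exists_min_image (Finset.powersetCard m (Finset.univ : Finset ι))
    (fun C => ∑ k ∈ C, f k) (Finset.powersetCard_nonempty.2 hm)
  exact ⟨C, (Finset.mem_powersetCard.1 hC).2, fun C' hC' =>
    h C' (Finset.mem_powersetCard.2 ⟨Finset.subset_univ _, hC'⟩)⟩

/-- The squared shortfalls are dominated by the weight of the alternatives to any decision `D`. -/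
lemma sum_shortfall_sq_le {ι : Type*} [DecidableEq ι] [Fintype ι] (A D : Finset ι) (m : ℕ)
    (hm : m ≤ Fintype.card ι) (b R : ℝ) (hR : 0 ≤ R) (x : ι → ℝ) {C₀ : Finset ι}
    (hC₀ : C₀.card = m) (hlt : ∑ k ∈ C₀, |x k| < b) :
    ∑ C ∈ Finset.powersetCard m Finset.univ, max (b + R - ∑ k ∈ C, x k) 0 ^ 2 ≤
      (Fintype.card ι).choose m * (2 * R ^ 2 + 16) * Real.exp b *
        ∑ B : Finset ι, if m ≤ (D ∆ B).card then Real.exp (-∑ k ∈ A ∆ B, x k) else 0 := by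
  obtain ⟨C₁, hC₁, hmin⟩ := exists_card_eq_sum_le m hm fun k => |x k|
  obtain ⟨B, hB, hle⟩ := exists_alternative A D C₁ x
  -- Here `n` is the total negative part, and `b - u` is the bound of `exists_alternative` for the
  -- minimizing block `C₁`. Thus `exp u` is at most `exp b` times one of the weights in the sum, and
  -- it remains to bound each squared shortfall by a multiple of `exp u`.
  set n : ℝ := ∑ k, max (-x k) 0 with hn
  set u : ℝ := b - ∑ k ∈ C₁, |x k| + n with hu
  have hn0 : 0 ≤ n := Finset.sum_nonneg fun _ _ => le_max_right _ _
  have hy0 : 0 ≤ b - ∑ k ∈ C₁, |x k| := by linarith [hmin C₀ hC₀]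
  have hterm : ∀ C ∈ Finset.powersetCard m (Finset.univ : Finset ι),
      max (b + R - ∑ k ∈ C, x k) 0 ^ 2 ≤ (2 * R ^ 2 + 16) * Real.exp u := by
    intro C hC
    have h1 : ∑ k ∈ C, |x k| ≤ ∑ k ∈ C, x k + 2 * n := by
      have : ∑ k ∈ C, max (-x k) 0 ≤ n := Finset.sum_le_sum_of_subset_of_nonneg
        (Finset.subset_univ _) fun _ _ _ => le_max_right _ _
      calc ∑ k ∈ C, |x k| = ∑ k ∈ C, (x k + 2 * max (-x k) 0) := by
            refine Finset.sum_congr rfl fun k _ => ?_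
            rcases le_total 0 (x k) with h | h
            · rw [abs_of_nonneg h, max_eq_right (by linarith)]; ring
            · rw [abs_of_nonpos h, max_eq_left (by linarith)]; ring
        _ ≤ _ := by rw [Finset.sum_add_distrib, ← Finset.mul_sum]; linarith
    have h2 : max (b + R - ∑ k ∈ C, x k) 0 ≤ R + 2 * u := by
      refine max_le ?_ (by linarith)
      linarith [hmin C (Finset.mem_powersetCard.1 hC).2]
    have hu0 : 0 ≤ u := by linarith
    -- The 16 in the constant is `8 * 2`: 8 from squaring `R + 2 * u`, and 2 from this bound.
    have h3 : u ^ 2 ≤ 2 * Real.exp u := by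
      have := Real.quadratic_le_exp_of_nonneg hu0
      linarith
    have h4 : 1 ≤ Real.exp u := Real.one_le_exp hu0
    calc max (b + R - ∑ k ∈ C, x k) 0 ^ 2 ≤ (R + 2 * u) ^ 2 := by
          gcongr
      _ ≤ 2 * R ^ 2 + 8 * u ^ 2 := by nlinarith [sq_nonneg (R - 2 * u)]
      _ ≤ 2 * R ^ 2 * Real.exp u + 8 * (2 * Real.exp u) := by nlinarith [sq_nonneg R]
      _ = _ := by ring
  have hexp : Real.exp u ≤ Real.exp b *
      ∑ B : Finset ι, if m ≤ (D ∆ B).card then Real.exp (-∑ k ∈ A ∆ B, x k) else 0 := by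
    have h5 : Real.exp (-∑ k ∈ A ∆ B, x k) ≤
        ∑ B : Finset ι, if m ≤ (D ∆ B).card then Real.exp (-∑ k ∈ A ∆ B, x k) else 0 := by
      refine le_of_eq_of_le ?_ (Finset.single_le_sum (fun B' _ => ?_) (Finset.mem_univ B))
      · rw [if_pos (hC₁ ▸ hB)]
      · split_ifs <;> positivity
    calc Real.exp u ≤ Real.exp (b + -∑ k ∈ A ∆ B, x k) := Real.exp_le_exp.2 (by linarith)
      _ = Real.exp b * Real.exp (-∑ k ∈ A ∆ B, x k) := Real.exp_add _ _
      _ ≤ _ := by gcongr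
  calc _ ≤ ∑ C ∈ Finset.powersetCard m (Finset.univ : Finset ι),
          (2 * R ^ 2 + 16) * Real.exp u := Finset.sum_le_sum hterm
    _ = (Fintype.card ι).choose m * (2 * R ^ 2 + 16) * Real.exp u := by
        rw [Finset.sum_const, Finset.card_powersetCard, nsmul_eq_mul, Finset.card_univ]; ring
    _ ≤ _ := by rw [mul_assoc _ (Real.exp b)]; gcongr

namespace StreamModel

variable {K : ℕ} {M : StreamModel K}

/-! ### Likelihood ratio of one observation -/

/-- The log-likelihood ratio of hypothesis `i` against `i'` for one observation of stream `k`. -/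
def logRatio (M : StreamModel K) (k : Fin K) (i i' : Fin 2) (x : M.X k) : ℝ :=
  Real.log ((M.f k i x : ℝ) / (M.f k i' x : ℝ))

lemma measurable_logRatio (k : Fin K) (i i' : Fin 2) : Measurable (M.logRatio k i i') :=
  Real.measurable_log.comp
    ((M.measurable_f k i).coe_nnreal_real.div (M.measurable_f k i').coe_nnreal_real)

lemma logRatio_swap (k : Fin K) (i i' : Fin 2) (x : M.X k) :
    M.logRatio k i i' x = -M.logRatio k i' i x := by
  rw [logRatio, logRatio, ← Real.log_inv, inv_div]

/-- Where the second density vanishes and the first does not, the extended logarithm is `∞`, which a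
finite second moment permits only on a null set. Used in both directions, this makes the two laws
mutually absolutely continuous. -/
lemma MomentAssumption.ae_pos (hM : M.MomentAssumption) (k : Fin K) {i i' : Fin 2} (h : i ≠ i') :
    ∀ᵐ x ∂(M.μ k), M.f k i x ≠ 0 → M.f k i' x ≠ 0 := by
  have hfin := (hM k i i' h).2.ne
  have hmeas : Measurable fun x => (ENNReal.log ((M.f k i x : ℝ≥0∞) / (M.f k i' x : ℝ≥0∞))).abs ^ 2 *
      (M.f k i x : ℝ≥0∞) := by
    have h1 := (M.measurable_f k i).coe_nnreal_ennreal
    have h2 := (M.measurable_f k i').coe_nnreal_ennreal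
    have h3 : Measurable EReal.abs := by
      have : EReal.abs = fun x : EReal =>
          if x ∈ ({⊥, ⊤} : Set EReal) then ⊤ else ENNReal.ofReal |x.toReal| := by
        ext x
        induction x <;> simp [EReal.abs_def]
      rw [this]
      exact Measurable.ite (by measurability) measurable_const
        (measurable_ereal_toReal.abs.ennreal_ofReal)
    exact ((h3.comp (ENNReal.measurable_log.comp (h1.div h2))).pow_const 2).mul h1
  filter_upwards [ae_lt_top hmeas hfin] with x hx h0 h1
  rw [h1, ENNReal.coe_zero, ENNReal.div_zero (by simpa using h0), ENNReal.log_top] at hx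
  simp [h0] at hx

lemma MomentAssumption.withDensity_obsLaw (hM : M.MomentAssumption) (k : Fin K) {i i' : Fin 2}
    (h : i ≠ i') :
    (M.obsLaw k i).withDensity (fun x => ENNReal.ofReal (Real.exp (-M.logRatio k i i' x))) =
      M.obsLaw k i' := by
  have hexp : Measurable fun x => ENNReal.ofReal (Real.exp (-M.logRatio k i i' x)) :=
    (Real.measurable_exp.comp (measurable_logRatio k i i').neg).ennreal_ofReal
  rw [obsLaw, obsLaw, ← withDensity_mul _ (M.measurable_f k i).coe_nnreal_ennreal hexp]
  refine withDensity_congr_ae ?_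
  filter_upwards [hM.ae_pos k h, hM.ae_pos k h.symm] with x h1 h2
  by_cases h0 : M.f k i x = 0
  -- Both densities vanish here, so the default value of the real logarithm at `0 / 0` is harmless.
  · have : M.f k i' x = 0 := by by_contra h3; exact h2 h3 h0
    simp [h0, this]
  · have h3 := h1 h0
    have p1 : (0 : ℝ) < M.f k i x := by positivity
    have p2 : (0 : ℝ) < M.f k i' x := by positivity
    rw [Pi.mul_apply, ← logRatio_swap, logRatio, Real.exp_log (by positivity),
      ← ENNReal.ofReal_coe_nnreal, ← ENNReal.ofReal_coe_nnreal, ← ENNReal.ofReal_mul p1.le]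
    congr 1
    field_simp

lemma MomentAssumption.memLp_logRatio (hM : M.MomentAssumption) (k : Fin K) {i i' : Fin 2}
    (h : i ≠ i') : MemLp (M.logRatio k i i') 2 (M.obsLaw k i) := by
  refine ⟨(measurable_logRatio k i i').aestronglyMeasurable, ?_⟩
  rw [eLpNorm_lt_top_iff_lintegral_rpow_enorm_lt_top (by norm_num) (by norm_num), obsLaw,
    lintegral_withDensity_eq_lintegral_mul _ (M.measurable_f k i).coe_nnreal_ennreal
      (by have := measurable_logRatio (M := M) k i i'; fun_prop)]
  refine lt_of_le_of_lt (lintegral_mono_ae ?_) (hM k i i' h).2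
  filter_upwards [hM.ae_pos k h] with x hx
  rw [Pi.mul_apply, mul_comm]
  by_cases h0 : M.f k i x = 0
  · simp [h0]
  · have h3 := hx h0
    gcongr
    simp only [ENNReal.toReal_ofNat, ENNReal.rpow_ofNat]
    gcongr
    have : ENNReal.log ((M.f k i x : ℝ≥0∞) / (M.f k i' x : ℝ≥0∞)) =
        ((M.logRatio k i i' x : ℝ) : EReal) := by
      rw [← ENNReal.coe_div h3, ENNReal.log_pos_real' (by simp; positivity)]
      simp [logRatio]
    rw [this, EReal.abs_def, Real.enorm_eq_ofReal_abs]

lemma MomentAssumption.integral_logRatio_pos (hM : M.MomentAssumption) (k : Fin K) {i i' : Fin 2}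
    (h : i ≠ i') : 0 < ∫ x, M.logRatio k i i' x ∂(M.obsLaw k i) := by
  rw [obsLaw, integral_withDensity_eq_integral_smul (M.measurable_f k i)]
  convert (hM k i i' h).1 using 3
  rw [NNReal.smul_def, smul_eq_mul, mul_comm]; rfl

/-! ### Signed walks and independence of observations -/

/-- The true hypothesis in stream `k` when `A` is the set of signals. -/
abbrev hyp (A : Finset (Fin K)) (k : Fin K) : Fin 2 := if k ∈ A then 1 else 0

/-- The false hypothesis in stream `k` when `A` is the set of signals. -/
abbrev altHyp (A : Finset (Fin K)) (k : Fin K) : Fin 2 := if k ∈ A then 0 else 1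

lemma hyp_ne_altHyp (A : Finset (Fin K)) (k : Fin K) : hyp A k ≠ altHyp A k := by
  unfold hyp altHyp; split_ifs <;> simp

/-- The log-likelihood ratio of stream `k` in favour of the hypothesis that is true under `A`. -/
def signedLlr (M : StreamModel K) (A : Finset (Fin K)) (k : Fin K) (t : ℕ) (ω : M.Path) : ℝ :=
  ∑ s ∈ Finset.range t, M.logRatio k (hyp A k) (altHyp A k) (ω k s)

lemma signedLlr_of_mem {A : Finset (Fin K)} {k : Fin K} (h : k ∈ A) (t : ℕ) (ω : M.Path) :
    M.signedLlr A k t ω = M.llr k t ω := by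
  simp only [signedLlr, hyp, altHyp, if_pos h]; rfl

lemma signedLlr_of_notMem {A : Finset (Fin K)} {k : Fin K} (h : k ∉ A) (t : ℕ) (ω : M.Path) :
    M.signedLlr A k t ω = -M.llr k t ω := by
  simp only [signedLlr, hyp, altHyp, if_neg h, logRatio_swap k 0 1, Finset.sum_neg_distrib]; rfl

lemma abs_signedLlr (A : Finset (Fin K)) (k : Fin K) (t : ℕ) (ω : M.Path) :
    |M.signedLlr A k t ω| = |M.llr k t ω| := by
  by_cases h : k ∈ A
  · rw [signedLlr_of_mem h]
  · rw [signedLlr_of_notMem h, abs_neg]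

lemma measurable_coord (k : Fin K) (s : ℕ) : Measurable fun ω : M.Path => ω k s :=
  (measurable_pi_apply s).comp (measurable_pi_apply k)

lemma law_eq_infinitePi (A : Finset (Fin K)) :
    M.law A = Measure.infinitePi fun k => Measure.infinitePi fun _ : ℕ => M.obsLaw k (hyp A k) :=
  (Measure.infinitePi_eq_pi _).symm

instance (A : Finset (Fin K)) : IsProbabilityMeasure (M.law A) := by
  rw [law_eq_infinitePi]; infer_instance

lemma law_map_coord (A : Finset (Fin K)) (k : Fin K) (s : ℕ) :
    (M.law A).map (fun ω => ω k s) = M.obsLaw k (hyp A k) := by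
  have h : (fun ω : M.Path => ω k s) = (fun x : ℕ → M.X k => x s) ∘ fun ω : M.Path => ω k := rfl
  rw [h, ← Measure.map_map (measurable_pi_apply s) (measurable_pi_apply k), law_eq_infinitePi,
    Measure.infinitePi_map_eval (fun k => Measure.infinitePi fun _ : ℕ => M.obsLaw k (hyp A k)) k,
    Measure.infinitePi_map_eval]

lemma measurePreserving_coord (A : Finset (Fin K)) (k : Fin K) (s : ℕ) :
    MeasurePreserving (fun ω : M.Path => ω k s) (M.law A) (M.obsLaw k (hyp A k)) :=
  ⟨measurable_coord k s, law_map_coord A k s⟩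

lemma iIndepFun_coord (A : Finset (Fin K)) :
    iIndepFun (fun (p : Fin K × ℕ) (ω : M.Path) => ω p.1 p.2) (M.law A) := by
  rw [law_eq_infinitePi]
  exact iIndepFun_uncurry_infinitePi' (𝓧 := fun k _ => M.X k) (X := fun _ _ x => x)
    (fun k (_ : ℕ) => M.obsLaw k (hyp A k)) fun _ _ => measurable_id

/-- The `σ`-field generated by the observation of stream `p.1` at time `p.2 + 1`. -/
@[reducible]
def coordSigma (M : StreamModel K) (p : Fin K × ℕ) : MeasurableSpace M.Path :=
  MeasurableSpace.comap (fun ω : M.Path => ω p.1 p.2) (M.mX p.1)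

lemma coordSigma_le (p : Fin K × ℕ) : M.coordSigma p ≤ inferInstanceAs (MeasurableSpace M.Path) :=
  (measurable_coord p.1 p.2).comap_le

lemma iIndep_coordSigma (A : Finset (Fin K)) : iIndep M.coordSigma (M.law A) :=
  (iIndepFun_iff_iIndep (fun p : Fin K × ℕ => M.mX p.1) _ _).1 (iIndepFun_coord A)

lemma filtration_eq (t : ℕ) :
    M.filtration t = ⨆ p ∈ {p : Fin K × ℕ | p.2 < t},
      M.coordSigma p := by
  refine le_antisymm ?_ ?_
  · refine iSup_le fun s => iSup_le fun hs => iSup_le fun k => ?_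
    exact le_iSup₂_of_le (f := fun (p : Fin K × ℕ) (_ : p ∈ {p : Fin K × ℕ | p.2 < t}) =>
      M.coordSigma p) (k, s) hs le_rfl
  · refine iSup₂_le fun p hp => ?_
    exact le_iSup_of_le p.2 (le_iSup_of_le hp (le_iSup_of_le p.1 le_rfl))

lemma measurable_coord_filtration {k : Fin K} {s t : ℕ} (h : s < t) :
    Measurable[M.filtration t] fun ω : M.Path => ω k s := by
  refine Measurable.mono (comap_measurable fun ω : M.Path => ω k s) ?_ le_rfl
  exact le_iSup_of_le s (le_iSup_of_le h (le_iSup_of_le k le_rfl))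

lemma measurable_llr_filtration (k : Fin K) (t : ℕ) : Measurable[M.filtration t] (M.llr k t) := by
  refine Finset.measurable_fun_sum _ fun s hs => ?_
  exact (measurable_logRatio k 1 0).comp (measurable_coord_filtration (Finset.mem_range.1 hs))

lemma measurable_signedLlr_filtration (A : Finset (Fin K)) (k : Fin K) (t : ℕ) :
    Measurable[M.filtration t] (M.signedLlr A k t) := by
  refine Finset.measurable_fun_sum _ fun s hs => ?_
  exact (measurable_logRatio k _ _).comp (measurable_coord_filtration (Finset.mem_range.1 hs))

/-- The observations at time `t + 1` are independent of the past. -/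
lemma indep_filtration (A : Finset (Fin K)) (t : ℕ) :
    Indep (M.filtration t) (⨆ p ∈ {p : Fin K × ℕ | p.2 = t},
      M.coordSigma p) (M.law A) := by
  rw [filtration_eq]
  refine indep_iSup_of_disjoint coordSigma_le (iIndep_coordSigma A) ?_
  rw [Set.disjoint_left]
  rintro p h1 h2
  exact (Nat.ne_of_lt h1) h2

/-! ### Change of measure -/

/-- Change of measure on the events observed up to time `t`. -/
lemma MomentAssumption.law_eq_setLIntegral (hM : M.MomentAssumption) (A B : Finset (Fin K)) (t : ℕ)
    {E : Set M.Path} (hE : MeasurableSet[M.filtration t] E) :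
    M.law B E = ∫⁻ ω in E, ENNReal.ofReal (Real.exp (-∑ k ∈ A ∆ B, M.signedLlr A k t ω))
      ∂(M.law A) := by
  -- The density of `P_B` against `P_A` is a product over coordinates; streams outside `A ∆ B` have
  -- the same law under both and contribute the factor 1.
  classical
  set g : ∀ k : Fin K, M.X k → ℝ≥0∞ := fun k x =>
    if k ∈ A ∆ B then ENNReal.ofReal (Real.exp (-M.logRatio k (hyp A k) (altHyp A k) x)) else 1
    with hg
  have hgm : ∀ k, Measurable (g k) := by
    intro k
    simp only [hg]
    split_ifs
    · exact (Real.measurable_exp.comp (measurable_logRatio k _ _).neg).ennreal_ofReal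
    · exact measurable_const
  have hgd : ∀ k, (M.obsLaw k (hyp A k)).withDensity (g k) = M.obsLaw k (hyp B k) := by
    intro k
    simp only [hg]
    split_ifs with h
    · rw [hM.withDensity_obsLaw k (hyp_ne_altHyp A k)]
      congr 1
      rw [Finset.mem_symmDiff] at h
      unfold hyp altHyp
      split_ifs <;> first | rfl | tauto
    · rw [show (fun _ : M.X k => (1 : ℝ≥0∞)) = 1 from rfl, withDensity_one]
      congr 1
      rw [Finset.mem_symmDiff] at h
      unfold hyp
      split_ifs <;> first | rfl | tauto
  set R : Finset (Fin K × ℕ) := Finset.univ ×ˢ Finset.range t with hR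
  have hdens : ∀ ω : M.Path,
      ENNReal.ofReal (Real.exp (-∑ k ∈ A ∆ B, M.signedLlr A k t ω)) =
        ∏ p ∈ R, g p.1 (ω p.1 p.2) := by
    intro ω
    rw [hR, Finset.prod_product, ← Finset.sum_neg_distrib, Real.exp_sum,
      ENNReal.ofReal_prod_of_nonneg fun _ _ => (Real.exp_pos _).le, ← Finset.univ_inter (A ∆ B),
      ← Finset.prod_ite_mem]
    refine Finset.prod_congr rfl fun k _ => ?_
    simp only [hg]
    split_ifs with h
    · rw [signedLlr, ← Finset.sum_neg_distrib, Real.exp_sum,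
        ENNReal.ofReal_prod_of_nonneg fun _ _ => (Real.exp_pos _).le]
    · simp
  -- On a cylinder over all coordinates before time `t`, both sides factor by independence, and the
  -- factors agree by `hgd`. These cylinders generate the `σ`-field, so a π-system argument
  -- concludes.
  have key : ∀ G : ∀ p : Fin K × ℕ, Set (M.X p.1), (∀ p, MeasurableSet (G p)) →
      M.law B (⋂ p ∈ R, (fun ω : M.Path => ω p.1 p.2) ⁻¹' G p) =
        ∫⁻ ω in ⋂ p ∈ R, (fun ω : M.Path => ω p.1 p.2) ⁻¹' G p, ∏ p ∈ R, g p.1 (ω p.1 p.2)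
          ∂(M.law A) := by
    intro G hG
    have hm : MeasurableSet (⋂ p ∈ R, (fun ω : M.Path => ω p.1 p.2) ⁻¹' G p) :=
      Finset.measurableSet_biInter _ fun p _ => measurable_coord p.1 p.2 (hG p)
    have hGg : ∀ p, Measurable ((G p).indicator (g p.1)) := fun p => (hgm p.1).indicator (hG p)
    rw [(iIndepFun_coord B).measure_inter_preimage_eq_mul _ fun p _ => hG p, ← lintegral_indicator hm]
    have : ∀ ω : M.Path, (⋂ p ∈ R, (fun ω : M.Path => ω p.1 p.2) ⁻¹' G p).indicator
        (fun ω : M.Path => ∏ p ∈ R, g p.1 (ω p.1 p.2)) ω =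
        ∏ p ∈ R, (G p).indicator (g p.1) (ω p.1 p.2) := by
      intro ω
      by_cases h : ∀ p ∈ R, ω p.1 p.2 ∈ G p
      · rw [Set.indicator_of_mem (by simpa using h)]
        exact Finset.prod_congr rfl fun p hp => (Set.indicator_of_mem (h p hp) _).symm
      · rw [Set.indicator_of_notMem (by simpa using h)]
        push Not at h
        obtain ⟨p, hp, hpG⟩ := h
        exact (Finset.prod_eq_zero hp (Set.indicator_of_notMem hpG _)).symm
    simp_rw [this]
    rw [lintegral_prod_eq_prod_lintegral_of_indepFun R
      (fun p (ω : M.Path) => (G p).indicator (g p.1) (ω p.1 p.2))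
      ((iIndepFun_coord A).comp (fun p => (G p).indicator (g p.1)) hGg)
      fun p => (hGg p).comp (measurable_coord p.1 p.2)]
    refine Finset.prod_congr rfl fun p _ => ?_
    rw [(measurePreserving_coord B p.1 p.2).measure_preimage (hG p).nullMeasurableSet, ← hgd,
      withDensity_apply _ (hG p), ← lintegral_indicator (hG p),
      ← (measurePreserving_coord A p.1 p.2).lintegral_comp (hGg p)]
  simp_rw [hdens]
  rw [← withDensity_apply _ (M.filtration.le t _ hE)]
  refine ext_on_measurableSpace_of_generate_finite _ (piiUnionInter (fun p : Fin K × ℕ =>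
      {s | MeasurableSet[M.coordSigma p] s})
      {p | p.2 < t}) ?_ (M.filtration.le t)
    ((filtration_eq t).trans (generateFrom_piiUnionInter_measurableSet M.coordSigma _).symm)
    (isPiSystem_piiUnionInter _ (fun p => @MeasurableSpace.isPiSystem_measurableSet _ (M.coordSigma p)) _) ?_ hE
  · rintro _ ⟨J, hJ, F, hF, rfl⟩
    choose! G hG hGF using hF
    -- A cylinder over `J` is padded with `Set.univ` to one over the full grid `R`, where the
    -- density lives.
    have hset : ⋂ p ∈ J, F p = ⋂ p ∈ R, (fun ω : M.Path => ω p.1 p.2) ⁻¹'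
        (if p ∈ J then G p else Set.univ) := by
      ext ω
      simp only [Set.mem_iInter]
      refine ⟨fun h p _ => ?_, fun h p hp => ?_⟩
      · split_ifs with hp
        · have := h p hp
          rwa [← hGF p hp] at this
        · trivial
      · have := h p (by simpa [hR] using hJ hp)
        rwa [if_pos hp, hGF p hp] at this
    have hmeas : ∀ p, MeasurableSet (if p ∈ J then G p else Set.univ) := by
      intro p
      split_ifs with hp
      · exact hG p hp
      · exact MeasurableSet.univ
    rw [hset, key _ hmeas, withDensity_apply]
    exact Finset.measurableSet_biInter _ fun p _ => measurable_coord p.1 p.2 (hmeas p)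
  · have := key (fun _ => Set.univ) fun _ => MeasurableSet.univ
    simp only [Set.preimage_univ, Set.iInter_univ] at this
    rw [this, withDensity_apply _ MeasurableSet.univ]

/-! ### The Sum-Intersection rule as a procedure -/

lemma card_filter_val_lt {m : ℕ} (hm : m ≤ K) :
    (Finset.univ.filter fun i : Fin K => i.val < m).card = m := by
  rw [Fin.card_filter_val_lt, min_eq_right hm]

lemma exists_sumSmallest_eq {m : ℕ} (hm : m ≤ K) (t : ℕ) (ω : M.Path) :
    ∃ C : Finset (Fin K), C.card = m ∧ M.sumSmallest m t ω = ∑ k ∈ C, |M.llr k t ω| := by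
  set σ := Tuple.sort fun k => |M.llr k t ω| with hσ
  refine ⟨(Finset.univ.filter fun i : Fin K => i.val < m).map σ.toEmbedding, ?_, ?_⟩
  · rw [Finset.card_map, card_filter_val_lt hm]
  · rw [Finset.sum_map]; rfl

/-- After sorting, the indices common to the first `m` and to the image of `C` cancel. The remaining
two sets have equal size and are separated by the order statistic of index `m - 1`. -/
lemma sumSmallest_le {m : ℕ} (hm1 : 1 ≤ m) (hm : m ≤ K) (t : ℕ) (ω : M.Path)
    {C : Finset (Fin K)} (hC : C.card = m) :
    M.sumSmallest m t ω ≤ ∑ k ∈ C, |M.llr k t ω| := by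
  set σ := Tuple.sort fun k => |M.llr k t ω| with hσ
  set g : Fin K → ℝ := fun i => |M.llr (σ i) t ω| with hg
  have hmono : Monotone g := Tuple.monotone_sort fun k => |M.llr k t ω|
  set S := Finset.univ.filter fun i : Fin K => i.val < m with hS
  set C' := C.map σ.symm.toEmbedding with hC'
  have hsum : ∑ k ∈ C, |M.llr k t ω| = ∑ i ∈ C', g i := by
    rw [hC', Finset.sum_map]
    simp [hg]
  have hcard : S.card = C'.card := by rw [hC', Finset.card_map, hC, hS, card_filter_val_lt hm]
  rw [hsum]
  change ∑ i ∈ S, g i ≤ _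
  rw [← Finset.sum_inter_add_sum_sdiff S C', ← Finset.sum_inter_add_sum_sdiff C' S,
    Finset.inter_comm C' S]
  have h1 : ∑ i ∈ S \ C', g i ≤ (S \ C').card • g ⟨m - 1, by omega⟩ := by
    refine Finset.sum_le_card_nsmul _ _ _ fun i hi => hmono ?_
    have : i.val < m := by simpa [hS] using (Finset.mem_sdiff.1 hi).1
    exact Fin.le_def.2 (by simp; omega)
  have h2 : (C' \ S).card • g ⟨m - 1, by omega⟩ ≤ ∑ i ∈ C' \ S, g i := by
    refine Finset.card_nsmul_le_sum _ _ _ fun i hi => hmono ?_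
    have : ¬ i.val < m := by simpa [hS] using (Finset.mem_sdiff.1 hi).2
    exact Fin.le_def.2 (by simp; omega)
  rw [Finset.card_sdiff_comm hcard] at h1
  linarith

/-- Eliminates the random sorting permutation: the stopping condition becomes a finite intersection
of conditions on fixed blocks, whose measurability is clear. -/
lemma le_sumSmallest_iff {m : ℕ} (hm1 : 1 ≤ m) (hm : m ≤ K) (b : ℝ) (t : ℕ) (ω : M.Path) :
    b ≤ M.sumSmallest m t ω ↔
      ∀ C ∈ Finset.powersetCard m (Finset.univ : Finset (Fin K)), b ≤ ∑ k ∈ C, |M.llr k t ω| := by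
  refine ⟨fun h C hC => h.trans (sumSmallest_le hm1 hm t ω (Finset.mem_powersetCard.1 hC).2),
    fun h => ?_⟩
  obtain ⟨C, hC, he⟩ := exists_sumSmallest_eq hm t ω
  rw [he]
  exact h C (Finset.mem_powersetCard.2 ⟨Finset.subset_univ _, hC⟩)

lemma measurableSet_le_sumSmallest {m : ℕ} (hm1 : 1 ≤ m) (hm : m ≤ K) (b : ℝ) (t : ℕ) :
    MeasurableSet[M.filtration t] {ω | b ≤ M.sumSmallest m t ω} := by
  simp only [le_sumSmallest_iff hm1 hm, Set.ofPred_forall]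
  refine Finset.measurableSet_biInter _ fun C _ => ?_
  refine @measurableSet_le _ _ _ _ _ (M.filtration t) _ _ _ _ _ measurable_const ?_
  exact Finset.measurable_fun_sum _ fun k _ =>
    continuous_abs.measurable.comp (measurable_llr_filtration k t)

lemma sumIntersection_T_le_iff (m : ℕ) (b : ℝ) (t : ℕ) (ω : M.Path) :
    (M.sumIntersection m b).T ω ≤ t ↔ ∃ s ≤ t, 1 ≤ s ∧ b ≤ M.sumSmallest m s ω := by
  constructor
  · intro h
    -- A strict bound by `t + 1` lets `iInf_lt_iff` produce an actual stopping index.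
    have h' : (M.sumIntersection m b).T ω < ((t + 1 : ℕ) : ℕ∞) :=
      lt_of_le_of_lt h (by exact_mod_cast Nat.lt_succ_self t)
    simp only [sumIntersection, iInf_lt_iff] at h'
    obtain ⟨s, hs, hlt⟩ := h'
    exact ⟨s, Nat.lt_succ_iff.1 (by exact_mod_cast hlt), hs⟩
  · rintro ⟨s, hst, hs⟩
    exact (iInf₂_le (f := fun (t : ℕ) (_ : 1 ≤ t ∧ b ≤ M.sumSmallest m t ω) => (t : ℕ∞)) s hs).trans
      (by exact_mod_cast hst)

lemma sumIntersection_T_eq {m : ℕ} {b : ℝ} {t : ℕ} {ω : M.Path}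
    (h : (M.sumIntersection m b).T ω = t) : 1 ≤ t ∧ b ≤ M.sumSmallest m t ω := by
  obtain ⟨s, hst, hs⟩ := (sumIntersection_T_le_iff m b t ω).1 h.le
  have h2 : (t : ℕ∞) ≤ s := h ▸ (sumIntersection_T_le_iff m b s ω).2 ⟨s, le_rfl, hs⟩
  have : t = s := le_antisymm (by exact_mod_cast h2) hst
  rwa [this]

lemma mem_sumIntersection_D_iff (m : ℕ) (b : ℝ) (k : Fin K) (ω : M.Path) :
    k ∈ (M.sumIntersection m b).D ω ↔
      ∃ t : ℕ, (M.sumIntersection m b).T ω = t ∧ 0 < M.llr k t ω := by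
  simp [sumIntersection]

lemma measurableSet_sumIntersection_T_le {m : ℕ} (hm1 : 1 ≤ m) (hm : m ≤ K) (b : ℝ) (t : ℕ) :
    MeasurableSet[M.filtration t] {ω | (M.sumIntersection m b).T ω ≤ t} := by
  have : {ω | (M.sumIntersection m b).T ω ≤ t} =
      ⋃ s ∈ {s : ℕ | s ≤ t ∧ 1 ≤ s}, {ω | b ≤ M.sumSmallest m s ω} := by
    ext ω
    simp [sumIntersection_T_le_iff, and_assoc]
  rw [this]
  exact @MeasurableSet.biUnion _ _ (M.filtration t) _ _ (Set.to_countable _) fun s hs =>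
    M.filtration.mono hs.1 _ (measurableSet_le_sumSmallest hm1 hm b s)

lemma isStoppingTime_sumIntersection {m : ℕ} (hm1 : 1 ≤ m) (hm : m ≤ K) (b : ℝ) :
    IsStoppingTime M.filtration (M.sumIntersection m b).T :=
  fun t => measurableSet_sumIntersection_T_le hm1 hm b t

lemma isProcedure_sumIntersection {m : ℕ} (hm1 : 1 ≤ m) (hm : m ≤ K) (b : ℝ) :
    M.IsProcedure (M.sumIntersection m b) := by
  refine ⟨fun ω => le_iInf₂ fun t ht => by exact_mod_cast ht.1,
    isStoppingTime_sumIntersection hm1 hm b, fun k => ?_⟩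
  have hs : ∀ s : ℕ, MeasurableSet[M.filtration s]
      ({ω | (M.sumIntersection m b).T ω = s} ∩ {ω | 0 < M.llr k s ω}) := fun s =>
    MeasurableSet.inter ((isStoppingTime_sumIntersection hm1 hm b).measurableSet_eq s)
      (@measurableSet_lt _ _ _ _ _ (M.filtration s) _ _ _ _ _ measurable_const
        (measurable_llr_filtration k s))
  refine ((isStoppingTime_sumIntersection hm1 hm b).measurableSet _).2 ⟨?_, ?_⟩
  · have : {ω | k ∈ (M.sumIntersection m b).D ω} =
        ⋃ s : ℕ, {ω | (M.sumIntersection m b).T ω = s} ∩ {ω | 0 < M.llr k s ω} := by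
      ext ω
      simp [mem_sumIntersection_D_iff]
    rw [this]
    exact MeasurableSet.iUnion fun s => le_iSup (fun t => M.filtration t) s _ (hs s)
  · intro i
    have : {ω | k ∈ (M.sumIntersection m b).D ω} ∩ {ω | (M.sumIntersection m b).T ω ≤ i} =
        ⋃ s ∈ {s : ℕ | s ≤ i},
          {ω | (M.sumIntersection m b).T ω = s} ∩ {ω | 0 < M.llr k s ω} := by
      ext ω
      simp only [Set.mem_inter_iff, Set.mem_ofPred_eq, mem_sumIntersection_D_iff, Set.mem_iUnion,
        exists_prop]
      constructor
      · rintro ⟨⟨s, hs, hl⟩, hi⟩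
        rw [hs] at hi
        exact ⟨s, by exact_mod_cast hi, hs, hl⟩
      · rintro ⟨s, hsi, hs, hl⟩
        refine ⟨⟨s, hs, hl⟩, ?_⟩
        rw [hs]
        exact_mod_cast hsi
    have h : MeasurableSet[M.filtration i] (⋃ s ∈ {s : ℕ | s ≤ i},
        {ω | (M.sumIntersection m b).T ω = s} ∩ {ω | 0 < M.llr k s ω}) :=
      @MeasurableSet.biUnion _ _ (M.filtration i) _ _ (Set.to_countable _) fun s hsi =>
        M.filtration.mono hsi _ (hs s)
    rw [← this] at h
    exact h

/-! ### Measurability of arbitrary procedures -/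

/-- The measurability properties of a procedure, at each fixed time. -/
lemma IsProcedure.measurableSet_T_eq {δ : M.Rule} (hδ : M.IsProcedure δ) (t : ℕ) :
    MeasurableSet[M.filtration t] {ω | δ.T ω = t} := by
  obtain ⟨-, hT, -⟩ := hδ
  exact hT.measurableSet_eq t

lemma IsProcedure.measurableSet_T_le {δ : M.Rule} (hδ : M.IsProcedure δ) (t : ℕ) :
    MeasurableSet[M.filtration t] {ω | δ.T ω ≤ t} := by
  obtain ⟨-, hT, -⟩ := hδ
  exact hT t

lemma IsProcedure.measurableSet_T_eq_D {δ : M.Rule} (hδ : M.IsProcedure δ) (t : ℕ)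
    (P : Finset (Fin K) → Prop) :
    MeasurableSet[M.filtration t] {ω | δ.T ω = t ∧ P (δ.D ω)} := by
  have hD : ∀ k, MeasurableSet[M.filtration t] ({ω | δ.T ω = t} ∩ {ω | k ∈ δ.D ω}) := by
    intro k
    obtain ⟨-, hT, hD⟩ := id hδ
    have h1 := (hD k).2 t
    have h2 := MeasurableSet.inter h1 (hT.measurableSet_eq t)
    convert h2 using 1
    ext ω
    simp only [Set.mem_inter_iff, Set.mem_ofPred_eq]
    constructor
    · rintro ⟨h, h'⟩
      exact ⟨⟨h', h.le⟩, h⟩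
    · rintro ⟨⟨h, -⟩, h'⟩
      exact ⟨h', h⟩
  have : {ω | δ.T ω = t ∧ P (δ.D ω)} = ⋃ D ∈ {D : Finset (Fin K) | P D},
      {ω | δ.T ω = t} ∩ ((⋂ k ∈ D, {ω | δ.T ω = t} ∩ {ω | k ∈ δ.D ω}) ∩
        ⋂ k ∈ Dᶜ, ({ω | δ.T ω = t} ∩ {ω | k ∈ δ.D ω})ᶜ) := by
    ext ω
    simp only [Set.mem_ofPred_eq, Set.mem_iUnion, Set.mem_inter_iff, Set.mem_iInter,
      Set.mem_compl_iff, exists_prop, Finset.mem_compl]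
    constructor
    · rintro ⟨h, hP⟩
      exact ⟨_, hP, h, fun k hk => ⟨h, hk⟩, fun k hk h' => hk h'.2⟩
    · rintro ⟨D, hP, h, h1, h2⟩
      have : δ.D ω = D := by
        ext k
        exact ⟨fun hk => by_contra fun hn => h2 k hn ⟨h, hk⟩, fun hk => (h1 k hk).2⟩
      exact ⟨h, this ▸ hP⟩
  rw [this]
  refine @MeasurableSet.biUnion _ _ (M.filtration t) _ _ (Set.to_countable _) fun D _ => ?_
  refine MeasurableSet.inter (hδ.measurableSet_T_eq t) (MeasurableSet.inter ?_ ?_)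
  · exact Finset.measurableSet_biInter _ fun k _ => hD k
  · exact Finset.measurableSet_biInter _ fun k _ => (hD k).compl

/-! ### The potential and its drift -/

/-- The increment at time `t + 1` of the signed log-likelihood ratio summed over `C`. -/
def blockStep (M : StreamModel K) (A C : Finset (Fin K)) (t : ℕ) (ω : M.Path) : ℝ :=
  ∑ k ∈ C, M.logRatio k (hyp A k) (altHyp A k) (ω k t)

/-- The sum of the squared shortfalls below the level `c` of the signed log-likelihood ratios
summed over the sets of `m` streams. -/
def potential (M : StreamModel K) (A : Finset (Fin K)) (m : ℕ) (c : ℝ) (t : ℕ) (ω : M.Path) : ℝ :=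
  ∑ C ∈ Finset.powersetCard m Finset.univ, max (c - ∑ k ∈ C, M.signedLlr A k t ω) 0 ^ 2

lemma sum_signedLlr_succ (A C : Finset (Fin K)) (t : ℕ) (ω : M.Path) :
    ∑ k ∈ C, M.signedLlr A k (t + 1) ω =
      ∑ k ∈ C, M.signedLlr A k t ω + M.blockStep A C t ω := by
  simp only [signedLlr, blockStep, Finset.sum_range_succ, Finset.sum_add_distrib]

lemma MomentAssumption.memLp_step (hM : M.MomentAssumption) (A : Finset (Fin K)) (k : Fin K)
    (t : ℕ) : MemLp (fun ω => M.logRatio k (hyp A k) (altHyp A k) (ω k t)) 2 (M.law A) :=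
  (hM.memLp_logRatio k (hyp_ne_altHyp A k)).comp_measurePreserving (measurePreserving_coord A k t)

lemma MomentAssumption.memLp_blockStep (hM : M.MomentAssumption) (A C : Finset (Fin K)) (t : ℕ) :
    MemLp (M.blockStep A C t) 2 (M.law A) :=
  memLp_finsetSum C fun k _ => hM.memLp_step A k t

lemma MomentAssumption.memLp_signedLlr (hM : M.MomentAssumption) (A : Finset (Fin K)) (k : Fin K)
    (t : ℕ) : MemLp (M.signedLlr A k t) 2 (M.law A) :=
  memLp_finsetSum _ fun s _ => hM.memLp_step A k s

lemma integral_comp_coord (A : Finset (Fin K)) (k : Fin K) (t : ℕ) {g : M.X k → ℝ}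
    (hg : Measurable g) :
    ∫ ω, g (ω k t) ∂(M.law A) = ∫ x, g x ∂(M.obsLaw k (hyp A k)) := by
  rw [← law_map_coord A k t, integral_map (measurable_coord k t).aemeasurable
    hg.aestronglyMeasurable]

lemma MomentAssumption.integral_blockStep (hM : M.MomentAssumption) (A C : Finset (Fin K))
    (t : ℕ) : ∫ ω, M.blockStep A C t ω ∂(M.law A) =
      ∑ k ∈ C, ∫ x, M.logRatio k (hyp A k) (altHyp A k) x ∂(M.obsLaw k (hyp A k)) := by
  simp only [blockStep]
  rw [integral_finsetSum _ fun k _ => (hM.memLp_step A k t).integrable (by norm_num)]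
  exact Finset.sum_congr rfl fun k _ => integral_comp_coord A k t (measurable_logRatio k _ _)

lemma MomentAssumption.integral_blockStep_sq_le (hM : M.MomentAssumption) (A C : Finset (Fin K))
    (t : ℕ) : ∫ ω, M.blockStep A C t ω ^ 2 ∂(M.law A) ≤
      ∑ k ∈ C, C.card * ∫ x, M.logRatio k (hyp A k) (altHyp A k) x ^ 2 ∂(M.obsLaw k (hyp A k)) := by
  have hi : ∀ k ∈ C, Integrable (fun ω : M.Path =>
      M.logRatio k (hyp A k) (altHyp A k) (ω k t) ^ 2) (M.law A) :=
    fun k _ => (hM.memLp_step A k t).integrable_sq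
  calc ∫ ω, M.blockStep A C t ω ^ 2 ∂(M.law A)
      ≤ ∫ ω, C.card * ∑ k ∈ C, M.logRatio k (hyp A k) (altHyp A k) (ω k t) ^ 2 ∂(M.law A) :=
        integral_mono (hM.memLp_blockStep A C t).integrable_sq
          ((integrable_finsetSum C hi).const_mul _) fun ω => sq_sum_le_card_mul_sum_sq
    _ = _ := by
        rw [integral_const_mul, integral_finsetSum C hi, Finset.mul_sum]
        refine Finset.sum_congr rfl fun k _ => ?_
        rw [integral_comp_coord A k t ((measurable_logRatio k (hyp A k) (altHyp A k)).pow_const 2)]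

lemma MomentAssumption.integral_blockStep_pos (hM : M.MomentAssumption) (A : Finset (Fin K))
    {C : Finset (Fin K)} (hC : C.Nonempty) (t : ℕ) : 0 < ∫ ω, M.blockStep A C t ω ∂(M.law A) := by
  rw [hM.integral_blockStep]
  exact Finset.sum_pos (fun k _ => hM.integral_logRatio_pos k (hyp_ne_altHyp A k)) hC

/-- A margin beyond which the drift of the shortfalls outweighs their fluctuations. -/
lemma MomentAssumption.exists_margin (hM : M.MomentAssumption) (A : Finset (Fin K)) {m : ℕ}
    (hm1 : 1 ≤ m) : ∃ R : ℝ, 0 ≤ R ∧ ∀ t : ℕ,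
      ∀ C ∈ Finset.powersetCard m (Finset.univ : Finset (Fin K)),
        1 + ∑ C' ∈ Finset.powersetCard m Finset.univ, ∫ ω, M.blockStep A C' t ω ^ 2 ∂(M.law A) ≤
          2 * R * ∫ ω, M.blockStep A C t ω ∂(M.law A) := by
  -- `Q` depends only on the one-observation laws, so a single `R` serves for every `t`.
  set Q : ℝ := 1 + ∑ C' ∈ Finset.powersetCard m (Finset.univ : Finset (Fin K)),
    ∑ k ∈ C', C'.card * ∫ x, M.logRatio k (hyp A k) (altHyp A k) x ^ 2 ∂(M.obsLaw k (hyp A k))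
    with hQ
  have hQ0 : 0 ≤ Q := by
    refine add_nonneg zero_le_one (Finset.sum_nonneg fun C' _ => Finset.sum_nonneg fun k _ => ?_)
    exact mul_nonneg (Nat.cast_nonneg _) (integral_nonneg fun x => sq_nonneg _)
  set μ : Finset (Fin K) → ℝ := fun C =>
    ∑ k ∈ C, ∫ x, M.logRatio k (hyp A k) (altHyp A k) x ∂(M.obsLaw k (hyp A k)) with hμ
  have hμ0 : ∀ C, 0 ≤ μ C := fun C =>
    Finset.sum_nonneg fun k _ => (hM.integral_logRatio_pos k (hyp_ne_altHyp A k)).le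
  have hμpos : ∀ C ∈ Finset.powersetCard m (Finset.univ : Finset (Fin K)), 0 < μ C := by
    intro C hC
    have h : C.Nonempty := Finset.card_pos.1 (by rw [(Finset.mem_powersetCard.1 hC).2]; omega)
    have := hM.integral_blockStep_pos A h 0
    rwa [hM.integral_blockStep] at this
  have hterm : ∀ C, 0 ≤ Q / (2 * μ C) := fun C => div_nonneg hQ0 (by linarith [hμ0 C])
  -- A sum over blocks in place of a maximum: it dominates each `Q / (2 * μ C)`.
  refine ⟨∑ C ∈ Finset.powersetCard m (Finset.univ : Finset (Fin K)), Q / (2 * μ C),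
    Finset.sum_nonneg fun C _ => hterm C, fun t C hC => ?_⟩
  rw [hM.integral_blockStep]
  calc _ ≤ Q := by
        rw [hQ]
        gcongr with C' _
        exact hM.integral_blockStep_sq_le A C' t
    _ = 2 * (Q / (2 * μ C)) * μ C := by
        have := (hμpos C hC).ne'
        field_simp
    _ ≤ _ := by
        have := Finset.single_le_sum (f := fun C => Q / (2 * μ C)) (fun C _ => hterm C) hC
        have := hμ0 C
        gcongr

lemma indep_filtration_blockStep (A C : Finset (Fin K)) (t : ℕ) :
    Indep (M.filtration t) (MeasurableSpace.comap (M.blockStep A C t) inferInstance) (M.law A) := by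
  refine indep_of_indep_of_le_right (indep_filtration A t) (Measurable.comap_le ?_)
  refine Finset.measurable_fun_sum _ fun k _ => (measurable_logRatio k _ _).comp ?_
  refine Measurable.mono (comap_measurable fun ω : M.Path => ω k t) ?_ le_rfl
  exact le_iSup₂_of_le (f := fun (p : Fin K × ℕ) (_ : p ∈ {p : Fin K × ℕ | p.2 = t}) =>
      M.coordSigma p) (k, t) rfl le_rfl

/-- While the Sum-Intersection rule has not stopped, the potential drifts downwards. -/
lemma MomentAssumption.setLIntegral_potential_succ_le (hM : M.MomentAssumption) (A : Finset (Fin K)) {m : ℕ}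
    (hm1 : 1 ≤ m) (hm : m ≤ K) {R : ℝ}
    (hR : ∀ t : ℕ, ∀ C ∈ Finset.powersetCard m (Finset.univ : Finset (Fin K)),
        1 + ∑ C' ∈ Finset.powersetCard m Finset.univ, ∫ ω, M.blockStep A C' t ω ^ 2 ∂(M.law A) ≤
          2 * R * ∫ ω, M.blockStep A C t ω ∂(M.law A)) (b : ℝ) (t : ℕ)
    {E : Set M.Path} (hE : MeasurableSet[M.filtration t] E)
    (hEb : ∀ ω ∈ E, M.sumSmallest m t ω < b) :
    (∫⁻ ω in E, ENNReal.ofReal (M.potential A m (b + R) (t + 1) ω) ∂(M.law A)) + M.law A E ≤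
      ∫⁻ ω in E, ENNReal.ofReal (M.potential A m (b + R) t ω) ∂(M.law A) := by
  simp only [potential, sum_signedLlr_succ]
  refine setLIntegral_sum_shortfall_sq_add_le (M.filtration.le t) _
    (fun C ω => ∑ k ∈ C, M.signedLlr A k t ω) (fun C => M.blockStep A C t)
    (fun C _ => Finset.measurable_fun_sum _ fun k _ => measurable_signedLlr_filtration A k t)
    (fun C _ => memLp_finsetSum C fun k _ => hM.memLp_signedLlr A k t)
    (fun C _ => Finset.measurable_fun_sum _ fun k _ =>
      (measurable_logRatio k _ _).comp (measurable_coord k t))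
    (fun C _ => hM.memLp_blockStep A C t) (fun C _ => indep_filtration_blockStep A C t)
    (fun C hC => (hM.integral_blockStep_pos A (Finset.card_pos.1 (by
      rw [(Finset.mem_powersetCard.1 hC).2]; omega)) t).le) b R (hR t) hE fun ω hω => ?_
  -- The block attaining the smallest absolute sum is the short one, since a signed sum never
  -- exceeds the absolute sum.
  obtain ⟨C, hC, he⟩ := exists_sumSmallest_eq hm t ω
  refine ⟨C, Finset.mem_powersetCard.2 ⟨Finset.subset_univ _, hC⟩, ?_⟩
  refine lt_of_le_of_lt (Finset.sum_le_sum fun k _ => ?_) (he ▸ hEb ω hω)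
  exact (le_abs_self _).trans (abs_signedLlr A k t ω).le

/-! ### Comparison with an arbitrary procedure -/

lemma sumSmallest_lt_of_lt {m : ℕ} {b : ℝ} {t : ℕ} (ht : 1 ≤ t) {ω : M.Path}
    (h : (t : ℕ∞) < (M.sumIntersection m b).T ω) : M.sumSmallest m t ω < b := by
  by_contra hle
  exact absurd ((sumIntersection_T_le_iff m b t ω).2 ⟨t, le_rfl, ht, not_lt.1 hle⟩) (not_le.2 h)

/-- The series counts the times from `τ` up to just before `σ`, that is `(σ - τ)⁺`; the form avoids
subtraction and covers infinite values. -/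
lemma enat_le_add_tsum (τ σ : ℕ∞) :
    ((σ : ℕ∞) : ℝ≥0∞) ≤ (τ : ℝ≥0∞) + ∑' t : ℕ, if τ ≤ t ∧ (t : ℕ∞) < σ then 1 else 0 := by
  induction τ using ENat.recTopCoe with
  | top => simp
  | coe n =>
    have key : ∀ N : ℕ, (N : ℕ∞) ≤ σ → (N : ℝ≥0∞) ≤
        (n : ℝ≥0∞) + ∑' t : ℕ, if (n : ℕ∞) ≤ t ∧ (t : ℕ∞) < σ then 1 else 0 := by
      intro N hN
      have h1 : ∑ t ∈ Finset.Ico n N, (1 : ℝ≥0∞) ≤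
          ∑' t : ℕ, if (n : ℕ∞) ≤ t ∧ (t : ℕ∞) < σ then 1 else 0 := by
        refine le_trans (Finset.sum_le_sum fun t ht => ?_) (ENNReal.sum_le_tsum (Finset.Ico n N))
        rw [Finset.mem_Ico] at ht
        rw [if_pos ⟨by exact_mod_cast ht.1, lt_of_lt_of_le (by exact_mod_cast ht.2) hN⟩]
      refine le_trans ?_ (add_le_add le_rfl h1)
      simp only [Finset.sum_const, Nat.card_Ico, nsmul_eq_mul, mul_one]
      exact_mod_cast (by omega : N ≤ n + (N - n))
    induction σ using ENat.recTopCoe with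
    | top =>
      refine le_of_eq_of_le (by simp) (ENNReal.iSup_natCast ▸ iSup_le fun N => key N le_top)
    | coe N => simpa using key N le_rfl

/-- Comparison of the Sum-Intersection rule with an arbitrary procedure. -/
lemma MomentAssumption.ess_sumIntersection_le (hM : M.MomentAssumption) (A : Finset (Fin K)) {m : ℕ}
    (hm1 : 1 ≤ m) (hm : m ≤ K) {R : ℝ}
    (hR : ∀ t : ℕ, ∀ C ∈ Finset.powersetCard m (Finset.univ : Finset (Fin K)),
        1 + ∑ C' ∈ Finset.powersetCard m Finset.univ, ∫ ω, M.blockStep A C' t ω ^ 2 ∂(M.law A) ≤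
          2 * R * ∫ ω, M.blockStep A C t ω ∂(M.law A)) (b : ℝ)
    {δ : M.Rule} (hδ : M.IsProcedure δ) :
    M.ess A (M.sumIntersection m b) ≤ M.ess A δ + ∑' t : ℕ,
      ∫⁻ ω in {ω | δ.T ω = t ∧ (t : ℕ∞) < (M.sumIntersection m b).T ω},
        ENNReal.ofReal (M.potential A m (b + R) t ω) ∂(M.law A) := by
  set T := (M.sumIntersection m b).T with hT
  set V : ℕ → M.Path → ℝ≥0∞ := fun t ω => ENNReal.ofReal (M.potential A m (b + R) t ω) with hV
  set E : ℕ → Set M.Path := fun t => {ω | δ.T ω ≤ t ∧ (t : ℕ∞) < T ω} with hE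
  set r : ℕ → ℝ≥0∞ := fun t => ∫⁻ ω in {ω | δ.T ω = t ∧ (t : ℕ∞) < T ω}, V t ω ∂(M.law A) with hr
  have hTm : ∀ t : ℕ, MeasurableSet[M.filtration t] {ω | (t : ℕ∞) < T ω} := by
    intro t
    have h := (measurableSet_sumIntersection_T_le (M := M) hm1 hm b t).compl
    convert h using 1
    ext ω; simp [hT]
  have hEm : ∀ t : ℕ, MeasurableSet[M.filtration t] (E t) := fun t =>
    MeasurableSet.inter (hδ.measurableSet_T_le t) (hTm t)
  have hstep : ∀ t, (∫⁻ ω in E t, V (t + 1) ω ∂(M.law A)) + M.law A (E t) ≤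
      ∫⁻ ω in E t, V t ω ∂(M.law A) := fun t => by
    refine hM.setLIntegral_potential_succ_le A hm1 hm hR b t (hEm t) fun ω hω => ?_
    -- `δ.T ≥ 1` matters: the rule may not stop at time 0, so only from `t = 1` on does running
    -- imply a sum below `b`.
    exact sumSmallest_lt_of_lt (by exact_mod_cast (hδ.1 ω).trans hω.1) hω.2
  -- Paths in `E (t + 1)` either were already in `E t` or enter because `δ` stops exactly at `t +
  -- 1`; `r` collects the potential brought in by the latter.
  have hsucc : ∀ t, ∫⁻ ω in E (t + 1), V (t + 1) ω ∂(M.law A) ≤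
      (∫⁻ ω in E t, V (t + 1) ω ∂(M.law A)) + r (t + 1) := by
    intro t
    refine le_trans (lintegral_mono_set ?_) (lintegral_union_le _ _ _)
    rintro ω ⟨h1, h2⟩
    rcases h1.eq_or_lt with h | h
    · exact Or.inr ⟨h, h2⟩
    · refine Or.inl ⟨?_, lt_trans (by exact_mod_cast Nat.lt_succ_self t) h2⟩
      exact Order.le_of_lt_add_one (by exact_mod_cast h)
  have hzero : ∫⁻ ω in E 0, V 0 ω ∂(M.law A) ≤ r 0 := by
    refine lintegral_mono_set fun ω h => ⟨?_, h.2⟩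
    exact le_antisymm h.1 (by simp)
  -- Each step spends `M.law A (E t)` and receives `r (t + 1)`. Everything is kept additive in
  -- `ℝ≥0∞`, so no finiteness of the potential is needed.
  have htel : ∀ n : ℕ, (∫⁻ ω in E n, V n ω ∂(M.law A)) + ∑ t ∈ Finset.range n, M.law A (E t) ≤
      ∑ t ∈ Finset.range (n + 1), r t := by
    intro n
    induction n with
    | zero => simpa using hzero
    | succ n ih =>
      rw [Finset.sum_range_succ, Finset.sum_range_succ _ (n + 1)]
      calc _ ≤ (∫⁻ ω in E n, V (n + 1) ω ∂(M.law A)) + r (n + 1) +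
              (∑ t ∈ Finset.range n, M.law A (E t) + M.law A (E n)) := by gcongr; exact hsucc n
        _ = ((∫⁻ ω in E n, V (n + 1) ω ∂(M.law A)) + M.law A (E n)) +
              ∑ t ∈ Finset.range n, M.law A (E t) + r (n + 1) := by ring
        _ ≤ _ := by gcongr; exact le_trans (by gcongr; exact hstep n) ih
  have hsum : ∑' t, M.law A (E t) ≤ ∑' t, r t := by
    rw [ENNReal.tsum_eq_iSup_nat]
    exact iSup_le fun n => le_add_self.trans ((htel n).trans (ENNReal.sum_le_tsum _))
  have hEm' : ∀ t, MeasurableSet (E t) := fun t => M.filtration.le t _ (hEm t)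
  calc M.ess A (M.sumIntersection m b)
      ≤ ∫⁻ ω, ((δ.T ω : ℝ≥0∞) + ∑' t : ℕ, (E t).indicator 1 ω) ∂(M.law A) := by
        refine lintegral_mono fun ω => (enat_le_add_tsum (δ.T ω) _).trans ?_
        refine add_le_add le_rfl (ENNReal.tsum_le_tsum fun t => ?_)
        simp [hE, Set.indicator_apply, hT]
    _ = M.ess A δ + ∑' t, M.law A (E t) := by
        rw [lintegral_add_right _ (Measurable.tsum fun t =>
          measurable_one.indicator (hEm' t)), lintegral_tsum fun t =>
          (measurable_one.indicator (hEm' t)).aemeasurable]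
        simp [lintegral_indicator_one (hEm' _), ess]
    _ ≤ _ := by gcongr

lemma IsProcedure.tsum_law_le {δ : M.Rule} (hδ : M.IsProcedure δ) (B : Finset (Fin K))
    (P : Finset (Fin K) → Prop) :
    ∑' t : ℕ, M.law B {ω | δ.T ω = t ∧ P (δ.D ω)} ≤ M.law B {ω | P (δ.D ω)} := by
  rw [← measure_iUnion]
  · exact measure_mono (Set.iUnion_subset fun t ω h => h.2)
  · intro s t hst
    rw [Function.onFun, Set.disjoint_left]
    rintro ω ⟨h1, -⟩ ⟨h2, -⟩
    exact hst (by exact_mod_cast h1.symm.trans h2)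
  · exact fun t => M.filtration.le t _ (hδ.measurableSet_T_eq_D t P)

/-- Up to a bounded factor, the gap between the expected sample sizes of the Sum-Intersection rule
with threshold `b` and of any other procedure is at most `exp b` times the sum of the error
probabilities of the latter. -/
lemma MomentAssumption.exists_ess_sumIntersection_le (hM : M.MomentAssumption)
    (A : Finset (Fin K)) {m : ℕ} (hm1 : 1 ≤ m) (hm : m ≤ K) :
    ∃ c : ℝ, 0 ≤ c ∧ ∀ (b : ℝ) (δ : M.Rule), M.IsProcedure δ →
      M.ess A (M.sumIntersection m b) ≤ M.ess A δ +
        ENNReal.ofReal (c * Real.exp b) *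
          ∑ B : Finset (Fin K), M.law B {ω | m ≤ (δ.D ω ∆ B).card} := by
  obtain ⟨R, hR0, hR⟩ := hM.exists_margin A hm1
  refine ⟨K.choose m * (2 * R ^ 2 + 16), by positivity, fun b δ hδ => ?_⟩
  set c : ℝ := K.choose m * (2 * R ^ 2 + 16) with hc
  have hc0 : 0 ≤ c * Real.exp b := by positivity
  refine (hM.ess_sumIntersection_le A hm1 hm hR b hδ).trans (add_le_add le_rfl ?_)
  set S : Finset (Fin K) → ℕ → Set M.Path := fun B t =>
    {ω | δ.T ω = t ∧ m ≤ (δ.D ω ∆ B).card} with hS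
  have hSm : ∀ B t, MeasurableSet (S B t) := fun B t =>
    M.filtration.le t _ (hδ.measurableSet_T_eq_D t fun D => m ≤ (D ∆ B).card)
  set L : Finset (Fin K) → ℕ → M.Path → ℝ≥0∞ := fun B t ω =>
    ENNReal.ofReal (Real.exp (-∑ k ∈ A ∆ B, M.signedLlr A k t ω)) with hL
  have hLm : ∀ B t, Measurable (L B t) := fun B t => by
    have : Measurable fun ω : M.Path => ∑ k ∈ A ∆ B, M.signedLlr A k t ω :=
      Finset.measurable_fun_sum _ fun k _ =>
        (measurable_signedLlr_filtration A k t).mono (M.filtration.le t) le_rfl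
    exact (Real.measurable_exp.comp this.neg).ennreal_ofReal
  have hterm : ∀ t : ℕ, ∫⁻ ω in {ω | δ.T ω = t ∧ (t : ℕ∞) < (M.sumIntersection m b).T ω},
      ENNReal.ofReal (M.potential A m (b + R) t ω) ∂(M.law A) ≤
        ENNReal.ofReal (c * Real.exp b) * ∑ B : Finset (Fin K), M.law B (S B t) := by
    intro t
    have hmG : MeasurableSet {ω | δ.T ω = t ∧ (t : ℕ∞) < (M.sumIntersection m b).T ω} := by
      have h1 := M.filtration.le t _ (hδ.measurableSet_T_eq t)
      have h2 := (M.filtration.le t _ (measurableSet_sumIntersection_T_le (M := M) hm1 hm b t)).compl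
      convert h1.inter h2 using 1
      ext ω; simp
    -- The bound of `sum_shortfall_sq_le` is applied pathwise with the decision `δ.D ω`; its weights
    -- are the likelihood ratios `L B t`, which integrate over `S B t` to error probabilities of
    -- `δ`.
    calc _ ≤ ∫⁻ ω in {ω | δ.T ω = t ∧ (t : ℕ∞) < (M.sumIntersection m b).T ω},
          ENNReal.ofReal (c * Real.exp b) * ∑ B : Finset (Fin K), (S B t).indicator (L B t) ω
            ∂(M.law A) := by
          refine setLIntegral_mono' hmG fun ω hω => ?_
          have ht : 1 ≤ t := by exact_mod_cast hω.1 ▸ hδ.1 ω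
          have hlt := sumSmallest_lt_of_lt ht hω.2
          obtain ⟨C, hC, he⟩ := exists_sumSmallest_eq hm t ω
          rw [he] at hlt
          simp only [← abs_signedLlr A] at hlt
          have := sum_shortfall_sq_le A (δ.D ω) m (by simpa using hm) b R hR0
            (fun k => M.signedLlr A k t ω) hC hlt
          rw [Fintype.card_fin] at this
          refine (ENNReal.ofReal_le_ofReal this).trans (le_of_eq ?_)
          rw [ENNReal.ofReal_mul hc0, ENNReal.ofReal_sum_of_nonneg fun B _ => by
            split_ifs <;> positivity]
          congr 1
          refine Finset.sum_congr rfl fun B _ => ?_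
          by_cases h : m ≤ (δ.D ω ∆ B).card
          · rw [if_pos h, Set.indicator_of_mem (show ω ∈ S B t from ⟨hω.1, h⟩)]
          · rw [if_neg h, Set.indicator_of_notMem (fun h' : ω ∈ S B t => h h'.2),
              ENNReal.ofReal_zero]
      _ ≤ ∫⁻ ω, ENNReal.ofReal (c * Real.exp b) *
            ∑ B : Finset (Fin K), (S B t).indicator (L B t) ω ∂(M.law A) :=
          setLIntegral_le_lintegral _ _
      _ = _ := by
          rw [lintegral_const_mul _ (Finset.measurable_fun_sum _ fun B _ =>
            (hLm B t).indicator (hSm B t)), lintegral_finsetSum _ fun B _ =>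
            (hLm B t).indicator (hSm B t)]
          congr 1
          refine Finset.sum_congr rfl fun B _ => ?_
          rw [lintegral_indicator (hSm B t), hM.law_eq_setLIntegral A B t
            (hδ.measurableSet_T_eq_D t fun D => m ≤ (D ∆ B).card)]
  refine (ENNReal.tsum_le_tsum hterm).trans ?_
  rw [ENNReal.tsum_mul_left, Summable.tsum_finsetSum fun _ _ => ENNReal.summable]
  gcongr with B _
  exact hδ.tsum_law_le B fun D => m ≤ (D ∆ B).card

/-! ### Finite expected sample size and almost sure termination -/

/-- The procedure that takes one observation and declares no signals. -/
def oneStepRule (M : StreamModel K) : M.Rule := ⟨fun _ => 1, fun _ => ∅⟩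

lemma isProcedure_oneStepRule : M.IsProcedure M.oneStepRule :=
  ⟨fun _ => le_rfl, isStoppingTime_const M.filtration 1, fun k => by
    simp [oneStepRule]⟩

/-- The comparison bound applies to any procedure, whatever its error probabilities; against one
that stops at time 1 every term on the right is finite. -/
lemma MomentAssumption.ess_sumIntersection_lt_top (hM : M.MomentAssumption)
    (A : Finset (Fin K)) {m : ℕ} (hm1 : 1 ≤ m) (hm : m ≤ K) (b : ℝ) :
    M.ess A (M.sumIntersection m b) < ⊤ := by
  obtain ⟨c, -, h⟩ := hM.exists_ess_sumIntersection_le A hm1 hm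
  refine (h b _ isProcedure_oneStepRule).trans_lt (ENNReal.add_lt_top.2 ⟨?_, ?_⟩)
  · simp [ess, oneStepRule]
  · exact ENNReal.mul_lt_top ENNReal.ofReal_lt_top
      (ENNReal.sum_lt_top.2 fun B _ => measure_lt_top _ _)

lemma MomentAssumption.law_sumIntersection_eq_top (hM : M.MomentAssumption)
    (A : Finset (Fin K)) {m : ℕ} (hm1 : 1 ≤ m) (hm : m ≤ K) (b : ℝ) :
    M.law A {ω | (M.sumIntersection m b).T ω = ⊤} = 0 := by
  set T := (M.sumIntersection m b).T with hT
  have hmeas : MeasurableSet {ω | T ω = ⊤} := by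
    have : {ω | T ω = ⊤} = ⋂ t : ℕ, {ω | T ω ≤ t}ᶜ := by
      ext ω
      simp [ENat.eq_top_iff_forall_gt]
    rw [this]
    exact MeasurableSet.iInter fun t =>
      (M.filtration.le t _ (measurableSet_sumIntersection_T_le hm1 hm b t)).compl
  by_contra hne
  refine (hM.ess_sumIntersection_lt_top A hm1 hm b).ne (top_le_iff.1 ?_)
  calc (⊤ : ℝ≥0∞) = ∫⁻ _ in {ω | T ω = ⊤}, ⊤ ∂(M.law A) := by
        rw [setLIntegral_const, ENNReal.top_mul hne]
    _ ≤ ∫⁻ ω in {ω | T ω = ⊤}, (T ω : ℝ≥0∞) ∂(M.law A) :=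
        setLIntegral_mono' hmeas fun ω (h : T ω = ⊤) => by rw [h]; simp
    _ ≤ _ := setLIntegral_le_lintegral _ _

/-! ### Error control -/

/-- Mistakes of the Sum-Intersection rule in all the streams of a given set are exponentially
unlikely. -/
lemma MomentAssumption.tsum_law_subset_symmDiff_le (hM : M.MomentAssumption)
    (A C : Finset (Fin K)) {m : ℕ} (hm1 : 1 ≤ m) (hm : m ≤ K) (hC : C.card = m) (b : ℝ) :
    ∑' t : ℕ, M.law A {ω | (M.sumIntersection m b).T ω = t ∧
      C ⊆ (M.sumIntersection m b).D ω ∆ A} ≤ ENNReal.ofReal (Real.exp (-b)) := by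
  have hδ := isProcedure_sumIntersection (M := M) hm1 hm b
  set δ := M.sumIntersection m b with hδdef
  -- If every stream of `C` is misjudged under `A`, then all of them are judged correctly under `B`.
  -- Their walks signed for `B` therefore equal the absolute values, which sum to at least `b` at
  -- stopping, and `dP_A/dP_B ≤ exp (-b)`.
  set B := A ∆ C with hB
  have hBA : B ∆ A = C := by rw [hB, symmDiff_comm, symmDiff_symmDiff_cancel_left]
  have hterm : ∀ t : ℕ, M.law A {ω | δ.T ω = t ∧ C ⊆ δ.D ω ∆ A} ≤
      ENNReal.ofReal (Real.exp (-b)) * M.law B {ω | δ.T ω = t ∧ C ⊆ δ.D ω ∆ A} := by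
    intro t
    have hm' := hδ.measurableSet_T_eq_D t fun D => C ⊆ D ∆ A
    rw [hM.law_eq_setLIntegral B A t hm', hBA, ← setLIntegral_const]
    refine setLIntegral_mono' (M.filtration.le t _ hm') fun ω hω => ENNReal.ofReal_le_ofReal
      (Real.exp_le_exp.2 (neg_le_neg ?_))
    refine (sumIntersection_T_eq hω.1).2.trans ((sumSmallest_le hm1 hm t ω hC).trans (le_of_eq ?_))
    refine Finset.sum_congr rfl fun k hk => ?_
    have hD : k ∈ δ.D ω ↔ 0 < M.llr k t ω := by
      rw [mem_sumIntersection_D_iff]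
      constructor
      · rintro ⟨s, hs, hl⟩
        have : s = t := by exact_mod_cast hs.symm.trans hω.1
        rwa [← this]
      · exact fun h => ⟨t, hω.1, h⟩
    have hk' := hω.2 hk
    rw [Finset.mem_symmDiff, hD] at hk'
    by_cases hkA : k ∈ A
    · have hkB : k ∉ B := by simp [hB, Finset.mem_symmDiff, hkA, hk]
      rw [signedLlr_of_notMem hkB, abs_of_nonpos]
      rcases hk' with h | h
      · exact absurd hkA h.2
      · exact not_lt.1 h.2
    · have hkB : k ∈ B := by simp [hB, Finset.mem_symmDiff, hkA, hk]
      rw [signedLlr_of_mem hkB, abs_of_pos]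
      rcases hk' with h | h
      · exact h.1
      · exact absurd h.1 hkA
  calc _ ≤ ∑' t : ℕ, ENNReal.ofReal (Real.exp (-b)) *
        M.law B {ω | δ.T ω = t ∧ C ⊆ δ.D ω ∆ A} := ENNReal.tsum_le_tsum hterm
    _ ≤ ENNReal.ofReal (Real.exp (-b)) * 1 := by
        rw [ENNReal.tsum_mul_left]
        gcongr
        exact (hδ.tsum_law_le B fun D => C ⊆ D ∆ A).trans prob_le_one
    _ = _ := mul_one _

/-- At least `m` mistakes means that some `m`-set consists of mistakes only, hence the binomial
factor. Paths that never stop, on which the decision is empty by convention, form a null set. -/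
lemma MomentAssumption.law_sumIntersection_error_le (hM : M.MomentAssumption)
    (A : Finset (Fin K)) {m : ℕ} (hm1 : 1 ≤ m) (hm : m ≤ K) (b : ℝ) :
    M.law A {ω | m ≤ ((M.sumIntersection m b).D ω ∆ A).card} ≤
      ENNReal.ofReal (K.choose m * Real.exp (-b)) := by
  set δ := M.sumIntersection m b with hδdef
  have hsub : {ω | m ≤ (δ.D ω ∆ A).card} ⊆ {ω | δ.T ω = ⊤} ∪
      ⋃ C ∈ Finset.powersetCard m (Finset.univ : Finset (Fin K)),
        ⋃ t : ℕ, {ω | δ.T ω = t ∧ C ⊆ δ.D ω ∆ A} := by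
    intro ω hω
    by_cases h : δ.T ω = ⊤
    · exact Or.inl h
    · right
      obtain ⟨t, ht⟩ := ENat.ne_top_iff_exists.1 h
      obtain ⟨C, hC, hcard⟩ := Finset.exists_subset_card_eq hω
      simp only [Set.mem_iUnion]
      exact ⟨C, Finset.mem_powersetCard.2 ⟨Finset.subset_univ _, hcard⟩, t, ht.symm, hC⟩
  calc _ ≤ M.law A {ω | δ.T ω = ⊤} +
        M.law A (⋃ C ∈ Finset.powersetCard m (Finset.univ : Finset (Fin K)),
          ⋃ t : ℕ, {ω | δ.T ω = t ∧ C ⊆ δ.D ω ∆ A}) :=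
        (measure_mono hsub).trans (measure_union_le _ _)
    _ ≤ 0 + ∑ C ∈ Finset.powersetCard m (Finset.univ : Finset (Fin K)),
          ENNReal.ofReal (Real.exp (-b)) := by
        rw [hM.law_sumIntersection_eq_top A hm1 hm b]
        gcongr
        refine (measure_biUnion_finset_le _ _).trans (Finset.sum_le_sum fun C hC => ?_)
        exact (measure_iUnion_le _).trans (hM.tsum_law_subset_symmDiff_le A C hm1 hm
          (Finset.mem_powersetCard.1 hC).2 b)
    _ = _ := by
        rw [zero_add, Finset.sum_const, Finset.card_powersetCard, Finset.card_univ,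
          Fintype.card_fin, nsmul_eq_mul, ENNReal.ofReal_mul (Nat.cast_nonneg _),
          ENNReal.ofReal_natCast]

end StreamModel

end SeqMultTest

end

/-! ### Second-order optimality -/

theorem mainTheorem5 {K : ℕ} (hK : 2 ≤ K) (M : SeqMultTest.StreamModel K)
    (hM : M.MomentAssumption) (m₀ : ℕ) (hm₀ : 1 ≤ m₀) (hm₀K : m₀ ≤ K) :
    M.IsSecondOrderOptimal
      (fun α => M.sumIntersection m₀ (|Real.log α| + Real.log (K.choose m₀)))
      (fun α => M.gmrClass m₀ α) := by
  have hch : (0 : ℝ) < K.choose m₀ := by exact_mod_cast Nat.choose_pos hm₀K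
  have hexp : ∀ α ∈ Set.Ioo (0 : ℝ) 1,
      Real.exp (|Real.log α| + Real.log (K.choose m₀)) = K.choose m₀ / α := by
    intro α hα
    rw [abs_of_neg (Real.log_neg hα.1 hα.2), Real.exp_add, Real.exp_log hch, Real.exp_neg,
      Real.exp_log hα.1]
    field_simp
  refine ⟨fun α hα => ⟨SeqMultTest.StreamModel.isProcedure_sumIntersection hm₀ hm₀K _,
    fun A => ?_⟩, fun A => ⟨fun α _ => hM.ess_sumIntersection_lt_top A hm₀ hm₀K _, ?_⟩⟩
  · refine (hM.law_sumIntersection_error_le A hm₀ hm₀K _).trans (le_of_eq ?_)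
    rw [Real.exp_neg, hexp α hα]
    congr 1
    have := hα.1.ne'
    field_simp
  · obtain ⟨c, hc0, hc⟩ := hM.exists_ess_sumIntersection_le A hm₀ hm₀K
    -- This is `c * exp b * α` summed over all `B`: `exp b` equals the binomial coefficient over
    -- `α`, so `α` cancels.
    set D : ℝ := c * K.choose m₀ * Fintype.card (Finset (Fin K)) with hD
    refine lt_of_le_of_lt (Filter.limsup_le_of_le (a := ((D : ℝ) : EReal)) (by isBoundedDefault) ?_)
      (EReal.coe_lt_top D)
    filter_upwards [Ioo_mem_nhdsGT (zero_lt_one' ℝ)] with α hα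
    set b := |Real.log α| + Real.log (K.choose m₀) with hb
    have hD0 : 0 ≤ D := by positivity
    have hle : M.ess A (M.sumIntersection m₀ b) ≤
        M.minEss A (M.gmrClass m₀ α) + ENNReal.ofReal D := by
      -- The constant is moved to the left so that the infimum over procedures can be bounded one
      -- procedure at a time.
      rw [← tsub_le_iff_right]
      refine le_iInf₂ fun δ hδ => ?_
      rw [tsub_le_iff_right]
      refine (hc b δ hδ.1).trans (add_le_add le_rfl ?_)
      calc _ ≤ ENNReal.ofReal (c * Real.exp b) * ∑ B : Finset (Fin K), ENNReal.ofReal α := by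
            gcongr with B _
            exact hδ.2 B
        _ = ENNReal.ofReal D := by
            rw [Finset.sum_const, Finset.card_univ, nsmul_eq_mul, ← ENNReal.ofReal_natCast,
              ← ENNReal.ofReal_mul (Nat.cast_nonneg _), ← ENNReal.ofReal_mul (by positivity),
              hexp α hα]
            congr 1
            have := hα.1.ne'
            rw [hD]
            field_simp
    refine EReal.sub_le_of_le_add' ?_
    have h := EReal.coe_ennreal_le_coe_ennreal_iff.2 hle
    rw [EReal.coe_ennreal_add, EReal.coe_ennreal_ofReal, max_eq_left hD0] at h
    rwa [add_comm] at h ⊢
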